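/- Let $\mu$ be a probability distribution on a measurable space $\mathcal{Z}$, let $\mathcal{W}=\mathbb{R}^d$ with the Euclidean norm, and let $\ell:\mathcal{W}\times\mathcal{Z}\to[0,\infty)$ be a measurable loss function. For $f:\mathcal{W}\to\mathbb{R}$ put $D^0f=f$ and, for $j\ge 1$ and unit vectors $v_1,\dots,v_j$, $$D^jf(w\mid v_1,\dots,v_j)=\lim_{c\to0}\frac{D^{j-1}f(w+cv_j\mid v_1,\dots,v_{j-1})-D^{j-1}f(w\mid v_1,\dots,v_{j-1})}{c}.$$ Suppose that for every $z\in\mathcal{Z}$ the function $f=\ell(\cdot,z)$ is infinitely smooth with all derivative bounds at most $\beta$, i.e. all these directional derivatives exist and $D^jf(w\mid v_1,\dots,v_j)\le\beta_j\le\beta$ for all $j\ge0$, all $w$ and all unit vectors $v_1,\dots,v_j$, and suppose that there is $\sigma>0$ with $\sup_{w\in\mathcal{W}}\mathbb{E}_{Z'\sim\mu}[\ell(w,Z')^2]\le\sigma^2$. For a randomized learning algorithm $\mathcal{A}$, i.e. a map assigning to each sample $S_n=(Z_1,\dots,Z_n)\in\mathcal{Z}^n$ a probability distribution $P_{W_n|S_n}$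 on $\mathcal{W}$ from which the output $W_n$ is drawn, let $$\overline{\mathrm{gen}}(W_n,S_n)=\mathbb{E}_{W\sim P_{W_n|S_n}}\Big[\mathbb{E}_{Z'\sim\mu}[\ell(W,Z')]-\frac1n\sum_{i=1}^n\ell(W,Z_i)\Big],$$ and let $\mathbb{W}_2^2(P,P')=\inf_\pi\int\|w-w'\|_2^2\,d\pi(w,w')\in[0,\infty]$ be the squared Wasserstein-2 distance, where the infimum is over all couplings $\pi$ of $P$ and $P'$. Then for every $\eta>0$, every probability distribution $P_1$ on $\mathcal{W}$, every $n>1$ and every $\delta\in(0,1)$, with probability at least $1-\delta$ over $Z_1,\dots,Z_n$ drawn i.i.d. from $\mu$, all learning algorithms simultaneously satisfy $$\overline{\mathrm{gen}}(W_n,S_n)\le\frac{2d\,\mathbb{W}_2^2(P_{W_n|S_n},P_1)}{\eta n}+2\beta^2\eta+\sqrt{\frac{2\sigma^2\log(1/\delta)}{n}}.$$ -/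

import Mathlib

open MeasureTheory
open scoped ENNReal

noncomputable section

/-- The hypothesis space `ℝ^d` with the Euclidean norm. -/
abbrev Hyp (d : ℕ) : Type := EuclideanSpace ℝ (Fin d)

/-- Iterated directional derivatives: `iterDirDeriv f [v_j, …, v_1] w` is
`D^j f(w | v_1, …, v_j)`. The head of the list is the direction of the last differentiation. -/
def iterDirDeriv {d : ℕ} (f : Hyp d → ℝ) : List (Hyp d) → Hyp d → ℝ
  | [] => f
  | v :: vs => fun w => lineDeriv ℝ (iterDirDeriv f vs) w v

/-- `f` is infinitely smooth with derivative bounds `b 0, b 1, …`: all iterated directional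
derivatives along unit vectors exist, and `D^j f(w | v_1, …, v_j) ≤ b j` for every `j`, every
point `w` and all unit directions. -/
def IsInfinitelySmooth {d : ℕ} (f : Hyp d → ℝ) (b : ℕ → ℝ) : Prop :=
  ∀ vs : List (Hyp d), (∀ v ∈ vs, ‖v‖ = 1) →
    (∀ w v : Hyp d, ‖v‖ = 1 → LineDifferentiableAt ℝ (iterDirDeriv f vs) w v) ∧
    (∀ w : Hyp d, iterDirDeriv f vs w ≤ b vs.length)

/-- `π` is a coupling of `P` and `Q`, that is, a joint distribution with these marginals. -/
def IsCoupling {d : ℕ} (π : Measure (Hyp d × Hyp d)) (P Q : Measure (Hyp d)) : Prop :=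
  π.map Prod.fst = P ∧ π.map Prod.snd = Q

/-- The squared Wasserstein-2 distance of two distributions on `ℝ^d` (possibly infinite). -/
def wassersteinTwoSq {d : ℕ} (P Q : Measure (Hyp d)) : ℝ≥0∞ :=
  ⨅ (π : Measure (Hyp d × Hyp d)) (_ : IsCoupling π P Q),
    ∫⁻ p, ENNReal.ofReal (‖p.1 - p.2‖ ^ 2) ∂π

variable {d n : ℕ} {Z : Type*} [MeasurableSpace Z]

/-- The risk (test error) of `w`. -/
def risk (ℓ : Hyp d → Z → ℝ) (μ : Measure Z) (w : Hyp d) : ℝ :=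
  ∫ z, ℓ w z ∂μ

/-- The empirical risk (training error) of `w` on the sample `s`. -/
def empRisk (ℓ : Hyp d → Z → ℝ) (w : Hyp d) (s : Fin n → Z) : ℝ :=
  (1 / (n : ℝ)) * ∑ i, ℓ w (s i)

/-- The generalization error of `w` on the sample `s`. -/
def genError (ℓ : Hyp d → Z → ℝ) (μ : Measure Z) (w : Hyp d) (s : Fin n → Z) : ℝ :=
  risk ℓ μ w - empRisk ℓ w s

/-- A randomized learning algorithm: it assigns to each sample `s` the distribution of its output,
which is the conditional distribution of `W_n` given `S_n = s`. -/
abbrev LearningAlgorithm (d n : ℕ) (Z : Type*) : Type _ :=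
  (Fin n → Z) → ProbabilityMeasure (Hyp d)

/-- The generalization error averaged over the internal randomness of the algorithm, that is,
`E[gen(W_n, S_n) | S_n = s]`. -/
def avgGenError (ℓ : Hyp d → Z → ℝ) (μ : Measure Z) (A : LearningAlgorithm d n Z)
    (s : Fin n → Z) : ℝ :=
  ∫ w, genError ℓ μ w s ∂(A s : Measure (Hyp d))

end

open Filter Topology InformationTheory

/-! Fix a centre `x`. The core is an exponential moment bound for the supremum over `w` of the
generalization error at `w` minus `c * ‖w - x‖ ^ 2`, where `c = 2 * d / (η * n)`. Averaging this
supremum over `x ∼ P₁` gives an event that does not involve the algorithm. On that event,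
integrating the pointwise inequality against any coupling of the output law with `P₁` produces the
Wasserstein term, for all algorithms at once.

Smoothness enters through Laplace noise. Averaging over such noise is inverted by `1 - b² ∂²`, so a
function with bounded derivatives is exactly the Laplace average of a function uniformly close to it
(`DirDerivsBounded.exists_laplace_deconv`). Hence the losses at all points `x + u` are integrals of
one function of oscillation at most `1.6 * β` against translates of one Laplace law, and the
divergence of a translate is at most quadratic in `u` (`integral_klFun_laplacePiRatio_le`). The
supremum over points thus becomes a supremum over mixtures penalized by their divergence, whose cost
does not depend on the number of points.

That supremum is `mixturePotential`, the convex conjugate of a multiple of the divergence. Strong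
convexity of the divergence makes it smooth: one more sample point adds a linear term and at most `2
/ 3 * G ^ 2 / τ` (`BoundedDensities.exists_potential_add_le`). The linear term is the mean minus the
value of a nonnegative variable with second moment at most `σ ^ 2`, hence sub-Gaussian from above
(`lintegral_exp_mul_integral_sub_le`). Iterating over the sample gives
`BoundedDensities.lintegral_exp_potential_le`; Jensen's inequality, Fubini and a Chernoff bound
finish the proof. -/

/-! ### Laplace noise on the line and its deconvolution. -/

/-- The Laplace distribution with scale `b`. -/
noncomputable def laplaceMeasure (b : ℝ) : Measure ℝ :=
  volume.withDensity fun y => ENNReal.ofReal (Real.exp (-|y| / b) / (2 * b))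

lemma measurable_laplaceDensity (b : ℝ) :
    Measurable fun y : ℝ => ENNReal.ofReal (Real.exp (-|y| / b) / (2 * b)) := by
  fun_prop

lemma integral_laplaceMeasure {b : ℝ} (hb : 0 < b) (g : ℝ → ℝ) :
    ∫ y, g y ∂(laplaceMeasure b) = (∫ y, Real.exp (-|y| / b) * g y) / (2 * b) := by
  rw [laplaceMeasure, integral_withDensity_eq_integral_toReal_smul
    (measurable_laplaceDensity b) (by simp), ← integral_div]
  refine integral_congr_ae (Eventually.of_forall fun y => ?_)
  have : 0 ≤ Real.exp (-|y| / b) / (2 * b) := by positivity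
  simp only [ENNReal.toReal_ofReal this, smul_eq_mul]
  ring

lemma integrableOn_exp_neg_div_Ioi {b : ℝ} (hb : 0 < b) :
    IntegrableOn (fun r : ℝ => Real.exp (-r / b)) (Set.Ioi 0) := by
  have := integrableOn_exp_mul_Ioi (a := -1 / b) (by rw [div_neg_iff]; right; simp [hb]) 0
  refine this.congr_fun (fun r _ => ?_) measurableSet_Ioi
  simp only
  congr 1
  ring

lemma integrable_exp_neg_abs_div {b : ℝ} (hb : 0 < b) :
    Integrable (fun r : ℝ => Real.exp (-|r| / b)) := by
  have h1 : IntegrableOn (fun r : ℝ => Real.exp (-|r| / b)) (Set.Ioi 0) :=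
    (integrableOn_exp_neg_div_Ioi hb).congr_fun
      (fun r hr => by simp [abs_of_pos (Set.mem_Ioi.1 hr)]) measurableSet_Ioi
  have h2 : IntegrableOn (fun r : ℝ => Real.exp (-|r| / b)) (Set.Iic 0) := by
    refine (integrableOn_exp_mul_Iic (a := 1 / b) (by positivity) 0).congr_fun
      (fun r hr => ?_) measurableSet_Iic
    simp only [abs_of_nonpos (Set.mem_Iic.1 hr)]
    congr 1
    ring
  rw [← integrableOn_univ, ← Set.Iic_union_Ioi (a := (0 : ℝ))]
  exact h2.union h1

/-- The integrand has the explicit antiderivative `-exp (-r / b) * (b * F r + b ^ 2 * F' r)`, which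
vanishes at infinity because `F` and `F'` are bounded. -/
lemma integral_Ioi_laplace_deconv {b : ℝ} (hb : 0 < b) {F F' F'' : ℝ → ℝ} {M : ℝ}
    (h1 : ∀ r, HasDerivAt F (F' r) r) (h2 : ∀ r, HasDerivAt F' (F'' r) r)
    (hF : ∀ r, |F r| ≤ M) (hF' : ∀ r, |F' r| ≤ M) (hF'' : ∀ r, |F'' r| ≤ M)
    (hc : Continuous F'') :
    ∫ r in Set.Ioi 0, Real.exp (-r / b) * (F r - b ^ 2 * F'' r) = b * F 0 + b ^ 2 * F' 0 := by
  have hcF : Continuous F := continuous_iff_continuousAt.2 fun r => (h1 r).continuousAt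
  have hder : ∀ r ∈ Set.Ici (0 : ℝ), HasDerivAt
      (fun r => -(Real.exp (-r / b) * (b * F r + b ^ 2 * F' r)))
      (Real.exp (-r / b) * (F r - b ^ 2 * F'' r)) r := by
    intro r _
    have he : HasDerivAt (fun r : ℝ => Real.exp (-r / b)) (Real.exp (-r / b) * (-1 / b)) r :=
      (((hasDerivAt_id r).neg).div_const b).exp
    have := (he.mul (((h1 r).const_mul b).add ((h2 r).const_mul (b ^ 2)))).neg
    refine HasDerivAt.congr_deriv this ?_
    simp only [Pi.add_apply]
    field_simp
    ring
  have hint : IntegrableOn (fun r => Real.exp (-r / b) * (F r - b ^ 2 * F'' r)) (Set.Ioi 0) := by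
    refine (integrableOn_exp_neg_div_Ioi hb).mul_bdd (c := M + b ^ 2 * M)
      (by fun_prop) (Eventually.of_forall fun r => ?_)
    rw [Real.norm_eq_abs]
    refine (abs_sub _ _).trans ?_
    rw [abs_mul, abs_of_nonneg (sq_nonneg b)]
    gcongr
    · exact hF r
    · exact hF'' r
  have htend : Tendsto (fun r => -(Real.exp (-r / b) * (b * F r + b ^ 2 * F' r))) atTop (𝓝 0) := by
    have hexp : Tendsto (fun r : ℝ => Real.exp (-r / b) * (b * M + b ^ 2 * M)) atTop (𝓝 0) := by
      have : Tendsto (fun r : ℝ => Real.exp (-r / b)) atTop (𝓝 0) := by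
        refine Real.tendsto_exp_atBot.comp ?_
        exact (tendsto_neg_atTop_atBot).atBot_div_const hb
      simpa using this.mul_const (b * M + b ^ 2 * M)
    refine squeeze_zero_norm (fun r => ?_) hexp
    rw [norm_neg, norm_mul, Real.norm_eq_abs, Real.abs_exp, Real.norm_eq_abs]
    gcongr
    refine (abs_add_le _ _).trans ?_
    rw [abs_mul, abs_mul, abs_of_pos hb, abs_of_nonneg (sq_nonneg b)]
    gcongr
    · exact hF r
    · exact hF' r
  rw [integral_Ioi_of_hasDerivAt_of_tendsto' hder hint htend]
  simp

/-- The operator `1 - b² (d/dr)²` inverts averaging over Laplace noise of scale `b`. -/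
lemma integral_laplace_deconv {b : ℝ} (hb : 0 < b) {F F' F'' : ℝ → ℝ} {M : ℝ}
    (h1 : ∀ r, HasDerivAt F (F' r) r) (h2 : ∀ r, HasDerivAt F' (F'' r) r)
    (hF : ∀ r, |F r| ≤ M) (hF' : ∀ r, |F' r| ≤ M) (hF'' : ∀ r, |F'' r| ≤ M)
    (hc : Continuous F'') :
    ∫ r, (F r - b ^ 2 * F'' r) ∂(laplaceMeasure b) = F 0 := by
  have hcF : Continuous F := continuous_iff_continuousAt.2 fun r => (h1 r).continuousAt
  have hint : Integrable (fun r => Real.exp (-|r| / b) * (F r - b ^ 2 * F'' r)) := by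
    refine (integrable_exp_neg_abs_div hb).mul_bdd (c := M + b ^ 2 * M)
      (by fun_prop) (Eventually.of_forall fun r => ?_)
    rw [Real.norm_eq_abs]
    refine (abs_sub _ _).trans ?_
    rw [abs_mul, abs_of_nonneg (sq_nonneg b)]
    gcongr
    · exact hF r
    · exact hF'' r
  rw [integral_laplaceMeasure hb, ← intervalIntegral.integral_Iic_add_Ioi (b := 0)
    hint.integrableOn hint.integrableOn]
  have e1 : ∫ r in Set.Ioi 0, Real.exp (-|r| / b) * (F r - b ^ 2 * F'' r)
      = b * F 0 + b ^ 2 * F' 0 := by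
    rw [← integral_Ioi_laplace_deconv hb h1 h2 hF hF' hF'' hc]
    refine setIntegral_congr_fun measurableSet_Ioi fun r hr => ?_
    simp only [abs_of_pos (Set.mem_Ioi.1 hr)]
  -- Reflection reverses the sign of `F'`, so the `F' 0` terms of the two half-lines cancel.
  have e2 : ∫ r in Set.Iic 0, Real.exp (-|r| / b) * (F r - b ^ 2 * F'' r)
      = b * F 0 - b ^ 2 * F' 0 := by
    have := integral_Ioi_laplace_deconv hb (F := fun r => F (-r)) (F' := fun r => -F' (-r))
      (F'' := fun r => F'' (-r)) (M := M)
      (fun r => by simpa [Function.comp_def] using (h1 (-r)).comp r (hasDerivAt_neg r))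
      (fun r => by simpa [Function.comp_def] using! ((h2 (-r)).comp r (hasDerivAt_neg r)).neg)
      (fun r => hF _) (fun r => by simpa using hF' _) (fun r => hF'' _) (by fun_prop)
    simp only [neg_zero] at this
    rw [sub_eq_add_neg, ← mul_neg, ← this]
    have h := integral_comp_neg_Ioi (0 : ℝ)
      (fun r => Real.exp (-|r| / b) * (F r - b ^ 2 * F'' r))
    rw [neg_zero] at h
    rw [← h]
    refine setIntegral_congr_fun measurableSet_Ioi fun r hr => ?_
    simp only [abs_neg, abs_of_pos (Set.mem_Ioi.1 hr)]
  rw [e1, e2]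
  field_simp
  ring

lemma isProbabilityMeasure_laplaceMeasure {b : ℝ} (hb : 0 < b) :
    IsProbabilityMeasure (laplaceMeasure b) := by
  have h := integral_laplace_deconv hb (F := fun _ => 1) (F' := fun _ => 0) (F'' := fun _ => 0)
    (M := 1) (fun r => hasDerivAt_const _ _) (fun r => hasDerivAt_const _ _) (by simp) (by simp)
    (by simp) continuous_const
  simp only [mul_zero, sub_zero, integral_const, smul_eq_mul, mul_one, Measure.real] at h
  exact ⟨(ENNReal.toReal_eq_one_iff _).1 h⟩

/-! ### Translates of Laplace laws: densities and divergences. -/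

/-- The density of the Laplace distribution centred at `a` relative to the centred one. -/
noncomputable def laplaceRatio (b a y : ℝ) : ℝ := Real.exp ((|y| - |y - a|) / b)

lemma laplaceRatio_pos (b a y : ℝ) : 0 < laplaceRatio b a y := Real.exp_pos _

@[fun_prop]
lemma continuous_laplaceRatio (b a : ℝ) : Continuous (laplaceRatio b a) := by
  unfold laplaceRatio; fun_prop

/-- Boundedness of the density ratio is an advantage of Laplace over Gaussian noise: it settles the
integrability questions for mixtures of translates. -/
lemma laplaceRatio_le {b : ℝ} (hb : 0 < b) (a y : ℝ) :
    laplaceRatio b a y ≤ Real.exp (|a| / b) := by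
  unfold laplaceRatio
  gcongr
  simpa using abs_sub_abs_le_abs_sub y (y - a)

lemma map_add_laplaceMeasure {b : ℝ} (hb : 0 < b) (a : ℝ) :
    (laplaceMeasure b).map (fun y => y + a) =
      (laplaceMeasure b).withDensity fun y => ENNReal.ofReal (laplaceRatio b a y) := by
  have hm : Measurable fun y => ENNReal.ofReal (laplaceRatio b a y) := by fun_prop
  ext s hs
  rw [Measure.map_apply (by fun_prop) hs, laplaceMeasure,
    ← withDensity_mul _ (measurable_laplaceDensity b) hm, withDensity_apply _ hs,
    withDensity_apply _ (hs.preimage (by fun_prop)),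
    ← lintegral_indicator hs, ← lintegral_indicator (hs.preimage (by fun_prop)),
    ← lintegral_add_right_eq_self (s.indicator _) a]
  refine lintegral_congr fun y => ?_
  by_cases hy : y + a ∈ s
  · rw [Set.indicator_of_mem (s := (fun y => y + a) ⁻¹' s) hy, Set.indicator_of_mem hy]
    simp only [Pi.mul_apply]
    rw [← ENNReal.ofReal_mul (by positivity), laplaceRatio, add_sub_cancel_right, div_mul_eq_mul_div,
      ← Real.exp_add]
    congr 4
    ring
  · rw [Set.indicator_of_notMem (s := (fun y => y + a) ⁻¹' s) hy, Set.indicator_of_notMem hy]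

/-- By symmetry `a` may be averaged with `-a`. Since `|y + a| + |y - a| = 2 * max |y| |a|`, the
excess is `2 * (|a| - |y|)` on `[-|a|, |a|]` and zero outside; bounding the exponential weight by
`1` leaves the area `2 * a ^ 2`. -/
lemma integral_abs_add_sub_abs_laplaceMeasure_le {b : ℝ} (hb : 0 < b) (a : ℝ) :
    ∫ y, (|y + a| - |y|) ∂(laplaceMeasure b) ≤ a ^ 2 / (2 * b) := by
  have hint : ∀ c : ℝ, Integrable (fun y => Real.exp (-|y| / b) * (|y + c| - |y|)) := fun c => by
    refine (integrable_exp_neg_abs_div hb).mul_bdd (c := |c|)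
      (by fun_prop) (Eventually.of_forall fun r => ?_)
    rw [Real.norm_eq_abs]
    simpa using abs_abs_sub_abs_le_abs_sub (r + c) r
  have hsymm : ∫ y, Real.exp (-|y| / b) * (|y + a| - |y|)
      = ∫ y, Real.exp (-|y| / b) * (|y + -a| - |y|) := by
    rw [← integral_neg_eq_self]
    refine integral_congr_ae (Eventually.of_forall fun y => ?_)
    simp only [abs_neg]
    rw [show -y + a = -(y + -a) by ring, abs_neg]
  have hkey : ∀ y : ℝ, Real.exp (-|y| / b) * (|y + a| - |y|)
      + Real.exp (-|y| / b) * (|y + -a| - |y|)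
      ≤ (Set.Icc (-|a|) |a|).indicator (fun y => 2 * (|a| - |y|)) y := by
    intro y
    rw [← mul_add]
    have hmax : |y + a| + |y + -a| = 2 * max |y| |a| := by
      rcases le_total |y| |a| with h | h
      · rw [max_eq_right h]
        rcases abs_cases y with h1 | h1 <;> rcases abs_cases a with h2 | h2 <;>
        rcases abs_cases (y + a) with h3 | h3 <;> rcases abs_cases (y + -a) with h4 | h4 <;>
        linarith
      · rw [max_eq_left h]
        rcases abs_cases y with h1 | h1 <;> rcases abs_cases a with h2 | h2 <;>
        rcases abs_cases (y + a) with h3 | h3 <;> rcases abs_cases (y + -a) with h4 | h4 <;>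
        linarith
    have hs : |y + a| - |y| + (|y + -a| - |y|) = 2 * (max |y| |a| - |y|) := by linarith
    rw [hs]
    have he : Real.exp (-|y| / b) ≤ 1 := by
      rw [Real.exp_le_one_iff, neg_div]
      have : 0 ≤ |y| / b := by positivity
      linarith
    by_cases hy : y ∈ Set.Icc (-|a|) |a|
    · rw [Set.indicator_of_mem hy]
      have hya : |y| ≤ |a| := abs_le.2 hy
      rw [max_eq_right hya]
      have : 0 ≤ 2 * (|a| - |y|) := by linarith
      nlinarith
    · rw [Set.indicator_of_notMem hy]
      have hya : |a| ≤ |y| := le_of_lt (not_le.1 fun h => hy (abs_le.1 h))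
      rw [max_eq_left hya]
      simp
  have hind : ∫ y, (Set.Icc (-|a|) |a|).indicator (fun y => 2 * (|a| - |y|)) y = 2 * a ^ 2 := by
    rw [integral_indicator measurableSet_Icc, integral_Icc_eq_integral_Ioc,
      ← intervalIntegral.integral_of_le (by linarith [abs_nonneg a]),
      ← intervalIntegral.integral_add_adjacent_intervals (b := 0)
        (Continuous.intervalIntegrable (by fun_prop) _ _)
        (Continuous.intervalIntegrable (by fun_prop) _ _)]
    have e1 : ∫ y in (-|a|)..0, 2 * (|a| - |y|) = ∫ y in (-|a|)..0, 2 * (|a| + y) := by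
      refine intervalIntegral.integral_congr fun y hy => ?_
      rw [Set.uIcc_of_le (by simp)] at hy
      simp only [abs_of_nonpos hy.2]
      ring
    have e2 : ∫ y in (0 : ℝ)..|a|, 2 * (|a| - |y|) = ∫ y in (0 : ℝ)..|a|, 2 * (|a| - y) := by
      refine intervalIntegral.integral_congr fun y hy => ?_
      rw [Set.uIcc_of_le (by simp)] at hy
      simp only [abs_of_nonneg hy.1]
    rw [e1, e2]
    simp only [intervalIntegral.integral_const_mul]
    rw [intervalIntegral.integral_add (by simp) (by simp),
      intervalIntegral.integral_sub (by simp) (by simp)]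
    simp only [intervalIntegral.integral_const, integral_id, smul_eq_mul]
    rw [← sq_abs a]
    ring
  have hle : 2 * ∫ y, Real.exp (-|y| / b) * (|y + a| - |y|) ≤ 2 * a ^ 2 := by
    rw [← hind, two_mul]
    nth_rewrite 2 [hsymm]
    rw [← integral_add (hint a) (hint (-a))]
    refine integral_mono ((hint a).add (hint (-a))) ?_ hkey
    exact (Continuous.integrableOn_Icc (by fun_prop)).integrable_indicator measurableSet_Icc
  rw [integral_laplaceMeasure hb]
  gcongr
  linarith

/-- The law of `k` independent Laplace variables of scale `b`. -/
noncomputable def laplacePi (k : ℕ) (b : ℝ) : Measure (Fin k → ℝ) :=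
  Measure.pi fun _ => laplaceMeasure b

lemma isProbabilityMeasure_laplacePi (k : ℕ) {b : ℝ} (hb : 0 < b) :
    IsProbabilityMeasure (laplacePi k b) := by
  have := isProbabilityMeasure_laplaceMeasure hb
  unfold laplacePi
  infer_instance

/-- The density of the translate by `w` of `laplacePi k b` relative to `laplacePi k b`. -/
noncomputable def laplacePiRatio {k : ℕ} (b : ℝ) (w y : Fin k → ℝ) : ℝ :=
  ∏ i, laplaceRatio b (w i) (y i)

lemma laplacePiRatio_pos {k : ℕ} (b : ℝ) (w y : Fin k → ℝ) : 0 < laplacePiRatio b w y :=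
  Finset.prod_pos fun i _ => laplaceRatio_pos b (w i) (y i)

@[fun_prop]
lemma continuous_laplacePiRatio {k : ℕ} (b : ℝ) (w : Fin k → ℝ) :
    Continuous (laplacePiRatio b w) := by
  unfold laplacePiRatio; fun_prop

lemma laplacePiRatio_le {k : ℕ} {b : ℝ} (hb : 0 < b) (w y : Fin k → ℝ) :
    laplacePiRatio b w y ≤ ∏ i, Real.exp (|w i| / b) :=
  Finset.prod_le_prod (fun i _ => (laplaceRatio_pos b (w i) (y i)).le)
    fun i _ => laplaceRatio_le hb (w i) (y i)

lemma lintegral_pi_prod_eq_prod {k : ℕ} (μ : Fin k → Measure ℝ) [∀ i, IsProbabilityMeasure (μ i)]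
    (f : Fin k → ℝ → ℝ≥0∞) (hf : ∀ i, Measurable (f i)) :
    ∫⁻ y, ∏ i, f i (y i) ∂(Measure.pi μ) = ∏ i, ∫⁻ t, f i t ∂(μ i) := by
  have hind := ProbabilityTheory.iIndepFun_pi (μ := μ) (X := fun i => f i)
    fun i => (hf i).aemeasurable
  rw [ProbabilityTheory.lintegral_prod_eq_prod_lintegral_of_indepFun Finset.univ
    (fun i (y : Fin k → ℝ) => f i (y i)) hind (fun i => (hf i).comp (measurable_pi_apply i))]
  refine Finset.prod_congr rfl fun i _ => ?_
  exact (measurePreserving_eval μ i).lintegral_comp (hf i)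

lemma map_add_laplacePi {k : ℕ} {b : ℝ} (hb : 0 < b) (w : Fin k → ℝ) :
    (laplacePi k b).map (fun y => y + w) =
      (laplacePi k b).withDensity fun y => ENNReal.ofReal (laplacePiRatio b w y) := by
  have := isProbabilityMeasure_laplaceMeasure hb
  have hp : ∀ i, IsProbabilityMeasure ((laplaceMeasure b).map fun t => t + w i) := fun i =>
    Measure.isProbabilityMeasure_map (by fun_prop)
  have h := Measure.pi_map_pi (μ := fun _ : Fin k => laplaceMeasure b)
    (f := fun i t => t + w i) (fun i => by fun_prop)
  refine Eq.trans h ?_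
  refine (Measure.pi_eq fun s hs => ?_)
  rw [withDensity_apply _ (.univ_pi hs), ← lintegral_indicator (.univ_pi hs)]
  have hprod : ∀ y : Fin k → ℝ, (Set.univ.pi s).indicator
      (fun y => ENNReal.ofReal (laplacePiRatio b w y)) y
      = ∏ i, (s i).indicator (fun t => ENNReal.ofReal (laplaceRatio b (w i) t)) (y i) := by
    intro y
    by_cases hy : y ∈ Set.univ.pi s
    · rw [Set.indicator_of_mem hy, laplacePiRatio,
        ENNReal.ofReal_prod_of_nonneg fun i _ => (laplaceRatio_pos b (w i) (y i)).le]
      refine Finset.prod_congr rfl fun i _ => ?_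
      rw [Set.indicator_of_mem (hy i trivial)]
    · rw [Set.indicator_of_notMem hy]
      simp only [Set.mem_pi, Set.mem_univ, true_implies, not_forall] at hy
      obtain ⟨i, hi⟩ := hy
      exact (Finset.prod_eq_zero (Finset.mem_univ i) (Set.indicator_of_notMem hi _)).symm
  rw [lintegral_congr hprod, laplacePi, lintegral_pi_prod_eq_prod]
  · refine Finset.prod_congr rfl fun i _ => ?_
    rw [map_add_laplaceMeasure hb, withDensity_apply _ (hs i), lintegral_indicator (hs i)]
  · intro i
    exact Measurable.indicator (by fun_prop) (hs i)

lemma integral_laplacePiRatio_mul {k : ℕ} {b : ℝ} (hb : 0 < b) (w : Fin k → ℝ)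
    {G : (Fin k → ℝ) → ℝ} (hG : Continuous G) :
    ∫ y, laplacePiRatio b w y * G y ∂(laplacePi k b) = ∫ y, G (y + w) ∂(laplacePi k b) := by
  rw [← integral_map (φ := fun y => y + w) (f := G) (by fun_prop) hG.aestronglyMeasurable,
    map_add_laplacePi hb, integral_withDensity_eq_integral_toReal_smul
    (by fun_prop) (by simp)]
  refine integral_congr_ae (Eventually.of_forall fun y => ?_)
  simp [ENNReal.toReal_ofReal (laplacePiRatio_pos b w y).le]

lemma integral_laplacePiRatio {k : ℕ} {b : ℝ} (hb : 0 < b) (w : Fin k → ℝ) :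
    ∫ y, laplacePiRatio b w y ∂(laplacePi k b) = 1 := by
  have := isProbabilityMeasure_laplacePi k hb
  simpa using integral_laplacePiRatio_mul hb w (G := fun _ => 1) continuous_const

lemma integrable_laplacePiRatio {k : ℕ} {b : ℝ} (hb : 0 < b) (w : Fin k → ℝ) :
    Integrable (laplacePiRatio b w) (laplacePi k b) :=
  -- A non-integrable function would have integral `0`, not `1`.
  not_not.1 fun h => by simpa [integral_undef h] using integral_laplacePiRatio hb w

lemma integrable_abs_add_sub_abs_laplaceMeasure {b : ℝ} (hb : 0 < b) (a : ℝ) :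
    Integrable (fun y => |y + a| - |y|) (laplaceMeasure b) := by
  have := isProbabilityMeasure_laplaceMeasure hb
  refine Integrable.of_bound (C := |a|) (by fun_prop) (Eventually.of_forall fun r => ?_)
  rw [Real.norm_eq_abs]
  simpa using abs_abs_sub_abs_le_abs_sub (r + a) r

lemma log_laplacePiRatio {k : ℕ} (b : ℝ) (w y : Fin k → ℝ) :
    Real.log (laplacePiRatio b w y) = ∑ i, (|y i| - |y i - w i|) / b := by
  rw [laplacePiRatio, Real.log_prod fun i _ => (laplaceRatio_pos b (w i) (y i)).ne']
  simp [laplaceRatio]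

/-- In `klFun r = r * log r + 1 - r` the last two terms integrate to zero, and the first is the mean
of the log-ratio under the translated law. -/
lemma integral_klFun_laplacePiRatio {k : ℕ} {b : ℝ} (hb : 0 < b) (w : Fin k → ℝ) :
    ∫ y, InformationTheory.klFun (laplacePiRatio b w y) ∂(laplacePi k b)
      = ∫ y, ∑ i, (|y i + w i| - |y i|) / b ∂(laplacePi k b) := by
  have := isProbabilityMeasure_laplacePi k hb
  have hcont : Continuous fun y : Fin k → ℝ => ∑ i, (|y i| - |y i - w i|) / b := by fun_prop
  have hbound : ∀ y : Fin k → ℝ, ‖∑ i, (|y i| - |y i - w i|) / b‖ ≤ ∑ i, |w i| / b := by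
    intro y
    refine (norm_sum_le _ _).trans (Finset.sum_le_sum fun i _ => ?_)
    rw [Real.norm_eq_abs, abs_div, abs_of_pos hb]
    refine div_le_div_of_nonneg_right ?_ hb.le
    simpa only [sub_sub_cancel] using abs_abs_sub_abs_le_abs_sub (y i) (y i - w i)
  have hint1 := integrable_laplacePiRatio hb w
  have hint : Integrable (fun y => laplacePiRatio b w y * ∑ i, (|y i| - |y i - w i|) / b)
      (laplacePi k b) :=
    hint1.mul_bdd hcont.aestronglyMeasurable (Eventually.of_forall hbound)
  have hint2 : Integrable (fun y => 1 - laplacePiRatio b w y) (laplacePi k b) :=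
    (integrable_const 1).sub hint1
  simp only [InformationTheory.klFun, log_laplacePiRatio, add_sub_assoc]
  rw [integral_add hint hint2, integral_sub (integrable_const 1) hint1,
    integral_laplacePiRatio hb, integral_laplacePiRatio_mul hb w hcont]
  simp

/-- The Kullback-Leibler divergence of a translate of the Laplace distribution is at most
quadratic in the shift. -/
lemma integral_klFun_laplacePiRatio_le {k : ℕ} {b : ℝ} (hb : 0 < b) (w : Fin k → ℝ) :
    ∫ y, InformationTheory.klFun (laplacePiRatio b w y) ∂(laplacePi k b)
      ≤ (∑ i, w i ^ 2) / (2 * b ^ 2) := by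
  have := isProbabilityMeasure_laplaceMeasure hb
  have hcont : ∀ i, Continuous fun t : ℝ => (|t + w i| - |t|) / b := fun i => by fun_prop
  have hI : ∀ i, Integrable (fun t : ℝ => (|t + w i| - |t|) / b) (laplaceMeasure b) := fun i =>
    (integrable_abs_add_sub_abs_laplaceMeasure hb (w i)).div_const b
  rw [integral_klFun_laplacePiRatio hb, laplacePi, integral_finsetSum _ fun i _ =>
    integrable_comp_eval (μ := fun _ : Fin k => laplaceMeasure b) (hI i), Finset.sum_div]
  refine Finset.sum_le_sum fun i _ => ?_
  rw [integral_comp_eval (μ := fun _ : Fin k => laplaceMeasure b) (i := i)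
    (f := fun t => (|t + w i| - |t|) / b) (hcont i).aestronglyMeasurable, integral_div]
  calc (∫ t, (|t + w i| - |t|) ∂(laplaceMeasure b)) / b ≤ (w i ^ 2 / (2 * b)) / b := by
        gcongr; exact integral_abs_add_sub_abs_laplaceMeasure_le hb (w i)
    _ = w i ^ 2 / (2 * b ^ 2) := by field_simp

/-! ### Bounded directional derivatives and deconvolution in several directions. -/

/-- All iterated directional derivatives of `f` along unit vectors exist and are bounded by `B`
in absolute value. -/
def DirDerivsBounded {d : ℕ} (f : Hyp d → ℝ) (B : ℝ) : Prop :=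
  ∀ vs : List (Hyp d), (∀ v ∈ vs, ‖v‖ = 1) →
    (∀ w v : Hyp d, ‖v‖ = 1 → LineDifferentiableAt ℝ (iterDirDeriv f vs) w v) ∧
    (∀ w : Hyp d, |iterDirDeriv f vs w| ≤ B)

/-- One-sided bounds become two-sided: flipping the sign of the last direction negates the
derivative, and at order zero nonnegativity takes over. -/
lemma IsInfinitelySmooth.dirDerivsBounded {d : ℕ} {f : Hyp d → ℝ} {b : ℕ → ℝ} {β : ℝ}
    (hf : IsInfinitelySmooth f b) (hb : ∀ j, b j ≤ β) (hf0 : ∀ w, 0 ≤ f w) :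
    DirDerivsBounded f β := by
  intro vs hvs
  refine ⟨(hf vs hvs).1, fun w => abs_le'.2 ⟨((hf vs hvs).2 w).trans (hb _), ?_⟩⟩
  cases vs with
  | nil =>
    have h0 := hf0 w
    have h1 := ((hf [] hvs).2 w).trans (hb _)
    simp only [iterDirDeriv] at h1 ⊢
    linarith
  | cons v vs =>
    have hneg : ∀ u ∈ (-v) :: vs, ‖u‖ = 1 := by
      intro u hu
      rcases List.mem_cons.1 hu with rfl | hu
      · rw [norm_neg]; exact hvs v List.mem_cons_self
      · exact hvs u (List.mem_cons_of_mem _ hu)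
    have h := ((hf _ hneg).2 w).trans (hb _)
    simpa only [iterDirDeriv, lineDeriv_neg] using h

lemma iterDirDeriv_iterDirDeriv {d : ℕ} (f : Hyp d → ℝ) (us vs : List (Hyp d)) :
    iterDirDeriv (iterDirDeriv f us) vs = iterDirDeriv f (vs ++ us) := by
  induction vs with
  | nil => rfl
  | cons v vs ih => simp only [iterDirDeriv, ih, List.cons_append]

lemma DirDerivsBounded.iterDirDeriv {d : ℕ} {f : Hyp d → ℝ} {B : ℝ} (hf : DirDerivsBounded f B)
    {us : List (Hyp d)} (hus : ∀ v ∈ us, ‖v‖ = 1) : DirDerivsBounded (iterDirDeriv f us) B := by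
  intro vs hvs
  rw [iterDirDeriv_iterDirDeriv]
  exact hf _ fun v hv => (List.mem_append.1 hv).elim (hvs v) (hus v)

lemma DirDerivsBounded.sub_const_mul {d : ℕ} {f g : Hyp d → ℝ} {B C c : ℝ} (hc : 0 ≤ c)
    (hf : DirDerivsBounded f B) (hg : DirDerivsBounded g C) :
    DirDerivsBounded (fun w => f w - c * g w) (B + c * C) := by
  have key : ∀ vs : List (Hyp d), (∀ v ∈ vs, ‖v‖ = 1) →
      _root_.iterDirDeriv (fun w => f w - c * g w) vs =
        fun w => _root_.iterDirDeriv f vs w - c * _root_.iterDirDeriv g vs w := by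
    intro vs
    induction vs with
    | nil => intro _; rfl
    | cons v vs ih =>
      intro hvs
      have hvs' : ∀ u ∈ vs, ‖u‖ = 1 := fun u hu => hvs u (List.mem_cons_of_mem _ hu)
      have hv := hvs v List.mem_cons_self
      funext w
      simp only [_root_.iterDirDeriv, ih hvs']
      have h1 := (((hf vs hvs').1 w v hv).hasLineDerivAt)
      have h2 := (((hg vs hvs').1 w v hv).hasLineDerivAt)
      exact HasLineDerivAt.lineDeriv (HasDerivAt.sub h1 (HasDerivAt.const_mul c h2))
  intro vs hvs
  rw [key vs hvs]
  refine ⟨fun w v hv => ?_, fun w => ?_⟩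
  · have h1 := (((hf vs hvs).1 w v hv).hasLineDerivAt)
    have h2 := (((hg vs hvs).1 w v hv).hasLineDerivAt)
    exact HasLineDerivAt.lineDifferentiableAt (HasDerivAt.sub h1 (HasDerivAt.const_mul c h2))
  · refine (abs_sub _ _).trans ?_
    rw [abs_mul, abs_of_nonneg hc]
    exact add_le_add ((hf vs hvs).2 w) (mul_le_mul_of_nonneg_left ((hg vs hvs).2 w) hc)

lemma DirDerivsBounded.abs_le {d : ℕ} {f : Hyp d → ℝ} {B : ℝ} (hf : DirDerivsBounded f B)
    (w : Hyp d) : |f w| ≤ B :=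
  (hf [] (by simp)).2 w

lemma DirDerivsBounded.hasDerivAt_line {d : ℕ} {f : Hyp d → ℝ} {B : ℝ}
    (hf : DirDerivsBounded f B) {v : Hyp d} (hv : ‖v‖ = 1) (x : Hyp d) (r : ℝ) :
    HasDerivAt (fun r : ℝ => f (x + r • v)) (_root_.iterDirDeriv f [v] (x + r • v)) r := by
  have h : HasDerivAt (fun t : ℝ => f (x + r • v + t • v)) (lineDeriv ℝ f (x + r • v) v) (r - r) := by
    rw [sub_self]
    exact ((hf [] (by simp)).1 (x + r • v) v hv).hasLineDerivAt
  have h2 := h.comp_sub_const r r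
  refine h2.congr_of_eventuallyEq (Eventually.of_forall fun s => ?_)
  simp only [sub_smul]
  congr 1
  abel

/-- Mean value inequality along the segment. Directional derivatives alone do not give continuity;
their uniform bound does, through this estimate. -/
lemma DirDerivsBounded.abs_sub_le {d : ℕ} {f : Hyp d → ℝ} {B : ℝ} (hf : DirDerivsBounded f B)
    (x y : Hyp d) : |f y - f x| ≤ B * ‖y - x‖ := by
  rcases eq_or_ne y x with rfl | hne
  · simp
  have hpos : 0 < ‖y - x‖ := norm_pos_iff.2 (sub_ne_zero.2 hne)
  set v : Hyp d := ‖y - x‖⁻¹ • (y - x) with hvdef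
  have hv : ‖v‖ = 1 := by
    rw [hvdef, norm_smul, norm_inv, norm_norm, inv_mul_cancel₀ hpos.ne']
  have h := Convex.norm_image_sub_le_of_norm_hasDerivWithin_le (C := B) (s := Set.univ)
    (f := fun r : ℝ => f (x + r • v)) (x := 0) (y := ‖y - x‖)
    (fun r _ => (hf.hasDerivAt_line hv x r).hasDerivWithinAt)
    (fun r _ => (hf [v] (by simpa using hv)).2 _) convex_univ trivial trivial
  simpa [hvdef, smul_smul, mul_inv_cancel₀ hpos.ne'] using h

lemma DirDerivsBounded.continuous {d : ℕ} {f : Hyp d → ℝ} {B : ℝ} (hf : DirDerivsBounded f B) :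
    Continuous f :=
  LipschitzWith.continuous (K := B.toNNReal) <| LipschitzWith.of_dist_le_mul fun x y => by
    rw [Real.dist_eq, dist_eq_norm, Real.coe_toNNReal B ((abs_nonneg _).trans (hf.abs_le 0))]
    exact hf.abs_sub_le y x

/-- A function with bounded directional derivatives is the average over Laplace noise, in finitely
many directions, of a function which is uniformly close to it. -/
lemma DirDerivsBounded.exists_laplace_deconv {d : ℕ} {f : Hyp d → ℝ} {B b : ℝ} (hb : 0 < b)
    (hf : DirDerivsBounded f B) (k : ℕ) (v : Fin k → Hyp d) (hv : ∀ i, ‖v i‖ = 1) :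
    ∃ g : Hyp d → ℝ, DirDerivsBounded g (B * (1 + b ^ 2) ^ k) ∧
      (∀ x, |g x - f x| ≤ B * ((1 + b ^ 2) ^ k - 1)) ∧
      ∀ x, ∫ y, g (x + ∑ i, y i • v i) ∂(laplacePi k b) = f x := by
  have := isProbabilityMeasure_laplaceMeasure hb
  induction k with
  | zero =>
    have := isProbabilityMeasure_laplacePi 0 hb
    exact ⟨f, by simpa using hf, by simp, fun x => by simp⟩
  | succ k ih =>
    obtain ⟨g, hg, hgf, hint⟩ := ih (fun i => v i.succ) fun i => hv _
    have hu : ∀ u ∈ [v 0, v 0], ‖u‖ = 1 := by simp [hv 0]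
    have hg2 := hg.iterDirDeriv hu
    have hG := hg.sub_const_mul (sq_nonneg b) hg2
    -- Inverting the noise along one more direction multiplies the bound by `1 + b ^ 2`. The errors
    -- telescope: `((1 + b ^ 2) ^ k - 1) + b ^ 2 * (1 + b ^ 2) ^ k = (1 + b ^ 2) ^ (k + 1) - 1`.
    refine ⟨fun w => g w - b ^ 2 * _root_.iterDirDeriv g [v 0, v 0] w, ?_, fun x => ?_, fun x => ?_⟩
    · convert hG using 1
      ring
    · have h1 := hgf x
      have h2 := hg2.abs_le x
      calc _ = |(g x - f x) - b ^ 2 * _root_.iterDirDeriv g [v 0, v 0] x| := by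
            congr 1; ring
        _ ≤ B * ((1 + b ^ 2) ^ k - 1) + b ^ 2 * (B * (1 + b ^ 2) ^ k) := by
            refine (abs_sub _ _).trans ?_
            rw [abs_mul, abs_of_nonneg (sq_nonneg b)]
            gcongr
        _ = _ := by ring
    · set G := fun w => g w - b ^ 2 * _root_.iterDirDeriv g [v 0, v 0] w
        with hGdef
      have hGc : Continuous G := hG.continuous
      have hline : ∀ z : Hyp d, ∫ r, G (z + r • v 0) ∂(laplaceMeasure b) = g z := by
        intro z
        have hu1 : ∀ u ∈ [v 0], ‖u‖ = 1 := by simp [hv 0]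
        have hg1 := hg.iterDirDeriv hu1
        have hgc2 := hg2.continuous
        have := integral_laplace_deconv hb (F := fun r => g (z + r • v 0))
          (F' := fun r => _root_.iterDirDeriv g [v 0] (z + r • v 0))
          (F'' := fun r => _root_.iterDirDeriv g [v 0, v 0] (z + r • v 0))
          (fun r => hg.hasDerivAt_line (hv 0) z r) (fun r => hg1.hasDerivAt_line (hv 0) z r)
          (fun r => hg.abs_le _) (fun r => hg1.abs_le _) (fun r => hg2.abs_le _) (by fun_prop)
        simpa using this
      have hmp := measurePreserving_piFinSuccAbove (fun _ : Fin (k + 1) => laplaceMeasure b) 0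
      have hmp' := hmp.symm
      -- The new coordinate is integrated innermost, which turns `G` back into `g`; the remaining
      -- coordinates are covered by induction.
      rw [laplacePi, ← hmp'.integral_comp' (fun y => G (x + ∑ i, y i • v i)),
        integral_prod_symm]
      · rw [← hint x, laplacePi]
        refine integral_congr_ae (Eventually.of_forall fun y => ?_)
        simp only
        rw [← hline]
        refine integral_congr_ae (Eventually.of_forall fun r => ?_)
        simp only [MeasurableEquiv.piFinSuccAbove_symm_apply, Fin.sum_univ_succ]
        simp [Fin.insertNthEquiv, add_comm, add_left_comm]
      · refine Integrable.of_bound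
          (C := B * (1 + b ^ 2) ^ k + b ^ 2 * (B * (1 + b ^ 2) ^ k)) ?_
          (Eventually.of_forall fun p => hG.abs_le _)
        refine Measurable.aestronglyMeasurable ?_
        refine Measurable.comp (g := fun y : Fin (k + 1) → ℝ => G (x + ∑ i, y i • v i)) ?_
          (MeasurableEquiv.measurable _)
        exact Continuous.measurable (by fun_prop)

/-! ### Strong convexity of `klFun`. -/

lemma two_mul_le_log_one_add_sub_log_one_sub {t : ℝ} (h0 : 0 ≤ t) (h1 : t < 1) :
    2 * t ≤ Real.log (1 + t) - Real.log (1 - t) := by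
  have h := Real.hasSum_log_sub_log_of_abs_lt_one (x := t) (by rwa [abs_of_nonneg h0])
  have := h.summable.sum_le_tsum {0} (fun k _ => by positivity)
  rw [h.tsum_eq] at this
  simpa using this

/-- The two sides agree at `0`, and the difference has derivative `log (1 + t) - log (1 - t) - 2 *
t`, which is nonnegative. -/
lemma sq_le_mul_log_one_add_add_mul_log_one_sub {t : ℝ} (h0 : 0 ≤ t) (h1 : t < 1) :
    t ^ 2 ≤ (1 + t) * Real.log (1 + t) + (1 - t) * Real.log (1 - t) := by
  have hder : ∀ s ∈ Set.Ico (0 : ℝ) 1, HasDerivAt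
      (fun s : ℝ => (1 + s) * Real.log (1 + s) + (1 - s) * Real.log (1 - s) - s ^ 2)
      (Real.log (1 + s) - Real.log (1 - s) - 2 * s) s := by
    intro s hs
    have hp : (1 + s) ≠ 0 := by linarith [hs.1]
    have hm : (1 - s) ≠ 0 := by linarith [hs.2]
    have e1 : HasDerivAt (fun s : ℝ => 1 + s) 1 s := (hasDerivAt_id s).const_add 1
    have e2 : HasDerivAt (fun s : ℝ => 1 - s) (-1) s := (hasDerivAt_id s).const_sub 1
    have := ((e1.mul (e1.log hp)).add (e2.mul (e2.log hm))).sub (hasDerivAt_pow 2 s)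
    refine HasDerivAt.congr_deriv this ?_
    field_simp
    ring
  have hmono : MonotoneOn
      (fun s : ℝ => (1 + s) * Real.log (1 + s) + (1 - s) * Real.log (1 - s) - s ^ 2)
      (Set.Ico 0 1) := by
    refine monotoneOn_of_deriv_nonneg (convex_Ico 0 1)
      (fun s hs => (hder s hs).continuousAt.continuousWithinAt)
      (fun s hs => (hder s (interior_subset hs)).differentiableAt.differentiableWithinAt)
      fun s hs => ?_
    have hs' := interior_subset hs
    rw [(hder s hs').deriv]
    linarith [two_mul_le_log_one_add_sub_log_one_sub hs'.1 hs'.2]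
  have := hmono (a := 0) (b := t) ⟨le_rfl, one_pos⟩ ⟨h0, h1⟩ h0
  norm_num at this
  linarith

/-- Strong midpoint convexity of `klFun`. -/
lemma two_mul_klFun_midpoint_add_le {x y : ℝ} (hx : 0 < x) (hy : 0 < y) :
    2 * klFun ((x + y) / 2) + (x - y) ^ 2 / (2 * (x + y)) ≤ klFun x + klFun y := by
  wlog hxy : y ≤ x generalizing x y
  · have := this hy hx (le_of_not_ge hxy)
    rw [add_comm x y, add_comm (klFun x)]
    rwa [← neg_sub y x, neg_sq]
  -- Writing `x = m * (1 + t)` and `y = m * (1 - t)` makes the `log m` terms cancel and leaves a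
  -- one-variable inequality in `t`.
  obtain ⟨m, hm⟩ : ∃ m, m = (x + y) / 2 := ⟨_, rfl⟩
  obtain ⟨t, ht⟩ : ∃ t, t = (x - y) / (x + y) := ⟨_, rfl⟩
  have hmpos : 0 < m := by rw [hm]; linarith
  have ht0 : 0 ≤ t := by rw [ht]; exact div_nonneg (by linarith) (by linarith)
  have ht1 : t < 1 := by rw [ht, div_lt_one (by linarith)]; linarith
  have ex : x = m * (1 + t) := by rw [hm, ht]; field_simp; ring
  have ey : y = m * (1 - t) := by rw [hm, ht]; field_simp; ring
  have e3 : (x - y) ^ 2 / (2 * (x + y)) = m * t ^ 2 := by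
    rw [hm, ht]; field_simp
  rw [← hm, e3]
  simp only [klFun]
  rw [ex, ey, Real.log_mul hmpos.ne' (by linarith), Real.log_mul hmpos.ne' (by linarith)]
  have := mul_le_mul_of_nonneg_left (sq_le_mul_log_one_add_add_mul_log_one_sub ht0 ht1) hmpos.le
  linarith

lemma mul_sub_sq_mul_le_sq_div {s : ℝ} (hs : 0 < s) (t c : ℝ) :
    t * c - c ^ 2 * s / 2 ≤ t ^ 2 / (2 * s) := by
  have : t ^ 2 / (2 * s) - (t * c - c ^ 2 * s / 2) = (t - c * s) ^ 2 / (2 * s) := by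
    field_simp
    ring
  have h2 : 0 ≤ (t - c * s) ^ 2 / (2 * s) := by positivity
  linarith

/-- Midpoint convexity is used twice, halving the way from `p` to `q` and then halving again. Each
quadratic gain is traded for a linear term by completing the square. The split of `c` into `2 / 3`
and `1 / 3` is optimal when `p` and `q` are densities: it minimizes `α ^ 2 + 2 * (1 - α) ^ 2`, with
value `2 / 3`. A single halving would give `1` instead, too large for the final constant since `1.6
^ 2 > 2`. -/
lemma klFun_strong_convexity {p q : ℝ} (hp : 0 < p) (hq : 0 < q) (c : ℝ) :
    4 * klFun ((p + 3 * q) / 4) - 3 * klFun q + (p - q) * c - c ^ 2 * (5 * p + 7 * q) / 18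
      ≤ klFun p := by
  have h1 := two_mul_klFun_midpoint_add_le hp hq
  have h2 := two_mul_klFun_midpoint_add_le (x := (p + q) / 2) (by linarith) hq
  have e1 : ((p + q) / 2 + q) / 2 = (p + 3 * q) / 4 := by ring
  have e2 : ((p + q) / 2 - q) ^ 2 / (2 * ((p + q) / 2 + q)) =
      (p - q) ^ 2 / (2 * (p + 3 * q)) / 2 := by
    have : p + 3 * q ≠ 0 := by positivity
    have : (p + q) / 2 + q = (p + 3 * q) / 2 := by ring
    rw [this]
    field_simp
    ring
  rw [e1, e2] at h2
  have h3 := mul_sub_sq_mul_le_sq_div (s := p + q) (by linarith) (p - q) (2 / 3 * c)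
  have h4 := mul_sub_sq_mul_le_sq_div (s := p + 3 * q) (by linarith) (p - q) (1 / 3 * c)
  linarith

/-! ### The divergence-regularized potential and its smoothness. -/

section Potential

variable {ι Y : Type*} [MeasurableSpace Y]

/-- A family of bounded positive probability densities relative to `ν`. -/
structure BoundedDensities (ν : Measure Y) (L : ι → Y → ℝ) (M : ℝ) : Prop where
  measurable : ∀ j, Measurable (L j)
  pos : ∀ j y, 0 < L j y
  le : ∀ j y, L j y ≤ M
  integral_eq_one : ∀ j, ∫ y, L j y ∂ν = 1

variable {ν : Measure Y} {L : ι → Y → ℝ} {M : ℝ}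

lemma BoundedDensities.integrable [IsFiniteMeasure ν] (hL : BoundedDensities ν L M) (j : ι) :
    Integrable (L j) ν :=
  Integrable.of_bound (C := M) (hL.measurable j).aestronglyMeasurable
    (Eventually.of_forall fun y => by
      rw [Real.norm_eq_abs, abs_of_pos (hL.pos j y)]; exact hL.le j y)

variable [Fintype ι]

/-- The mixture with weights `p` of the densities `L`. -/
def mixture (L : ι → Y → ℝ) (p : ι → ℝ) (y : Y) : ℝ := ∑ j, p j * L j y

/-- The divergence from the reference measure `ν` of the mixture with weights `p` of the
densities `L`. -/
noncomputable def mixtureDivergence (ν : Measure Y) (L : ι → Y → ℝ) (p : ι → ℝ) : ℝ :=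
  ∫ y, klFun (mixture L p y) ∂ν

lemma BoundedDensities.measurable_mixture (hL : BoundedDensities ν L M) (p : ι → ℝ) :
    Measurable (mixture L p) := by
  have := hL.measurable
  unfold mixture
  fun_prop

lemma BoundedDensities.mixture_pos (hL : BoundedDensities ν L M) {p : ι → ℝ}
    (hp : p ∈ stdSimplex ℝ ι) (y : Y) : 0 < mixture L p y := by
  obtain ⟨j, hj⟩ : ∃ j, 0 < p j := by
    by_contra! h
    have := Finset.sum_nonpos fun j (_ : j ∈ Finset.univ) => h j
    linarith [hp.2]
  exact Finset.sum_pos' (fun i _ => mul_nonneg (hp.1 i) (hL.pos i y).le)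
    ⟨j, Finset.mem_univ j, mul_pos hj (hL.pos j y)⟩

lemma BoundedDensities.mixture_le (hL : BoundedDensities ν L M) {p : ι → ℝ}
    (hp : p ∈ stdSimplex ℝ ι) (y : Y) : mixture L p y ≤ M := by
  calc mixture L p y ≤ ∑ j, p j * M :=
        Finset.sum_le_sum fun j _ => mul_le_mul_of_nonneg_left (hL.le j y) (hp.1 j)
    _ = M := by rw [← Finset.sum_mul, hp.2, one_mul]

lemma BoundedDensities.exists_klFun_bound (hL : BoundedDensities ν L M) :
    ∃ K, ∀ p ∈ stdSimplex ℝ ι, ∀ y, ‖klFun (mixture L p y)‖ ≤ K := by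
  obtain ⟨K, hK⟩ := (isCompact_Icc (a := (0 : ℝ)) (b := M)).exists_bound_of_continuousOn
    continuous_klFun.continuousOn
  exact ⟨K, fun p hp y => hK _ ⟨(hL.mixture_pos hp y).le, hL.mixture_le hp y⟩⟩

lemma BoundedDensities.divergence_nonneg (hL : BoundedDensities ν L M) {p : ι → ℝ}
    (hp : p ∈ stdSimplex ℝ ι) : 0 ≤ mixtureDivergence ν L p :=
  integral_nonneg fun y => klFun_nonneg (hL.mixture_pos hp y).le

/-- The convex conjugate of `τ` times the divergence of mixtures. -/
noncomputable def mixturePotential (ν : Measure Y) (L : ι → Y → ℝ) (τ : ℝ) (x : ι → ℝ) : ℝ :=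
  sSup ((fun p : stdSimplex ℝ ι => ∑ j, p.1 j * x j - τ * mixtureDivergence ν L p) '' Set.univ)

lemma mixturePotential_le [Nonempty ι] {τ : ℝ} {x : ι → ℝ} {c : ℝ}
    (h : ∀ p ∈ stdSimplex ℝ ι, ∑ j, p j * x j - τ * mixtureDivergence ν L p ≤ c) :
    mixturePotential ν L τ x ≤ c := by
  classical
  refine csSup_le (Set.Nonempty.image _ ?_) ?_
  · exact ⟨⟨_, single_mem_stdSimplex ℝ (Classical.arbitrary ι)⟩, trivial⟩
  · rintro _ ⟨p, -, rfl⟩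
    exact h p p.2

lemma BoundedDensities.potential_zero_le [Nonempty ι] (hL : BoundedDensities ν L M) {τ : ℝ} (hτ : 0 ≤ τ) :
    mixturePotential ν L τ 0 ≤ 0 :=
  mixturePotential_le fun p hp => by
    simpa using mul_nonneg hτ (hL.divergence_nonneg hp)

variable [IsProbabilityMeasure ν]

lemma BoundedDensities.integrable_mixture (hL : BoundedDensities ν L M) (p : ι → ℝ) :
    Integrable (mixture L p) ν :=
  integrable_finsetSum _ fun j _ => (hL.integrable j).const_mul (p j)

lemma BoundedDensities.integral_mixture_mul (hL : BoundedDensities ν L M) (p : ι → ℝ)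
    {g : Y → ℝ} (hg : Measurable g) {G : ℝ} (hG : ∀ y, |g y| ≤ G) :
    ∫ y, mixture L p y * g y ∂ν = ∑ j, p j * ∫ y, L j y * g y ∂ν := by
  simp only [mixture, Finset.sum_mul, mul_assoc]
  rw [integral_finsetSum _ fun j _ => ?_]
  · simp only [integral_const_mul]
  · exact ((hL.integrable j).mul_bdd hg.aestronglyMeasurable
      (Eventually.of_forall hG)).const_mul (p j)

lemma BoundedDensities.integral_mixture (hL : BoundedDensities ν L M) {p : ι → ℝ}
    (hp : p ∈ stdSimplex ℝ ι) : ∫ y, mixture L p y ∂ν = 1 := by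
  have := hL.integral_mixture_mul p (g := fun _ => 1) measurable_const (G := 1) (by simp)
  simpa [hL.integral_eq_one, hp.2] using this

lemma BoundedDensities.integrable_klFun (hL : BoundedDensities ν L M) {p : ι → ℝ}
    (hp : p ∈ stdSimplex ℝ ι) : Integrable (fun y => klFun (mixture L p y)) ν := by
  obtain ⟨K, hK⟩ := hL.exists_klFun_bound
  exact Integrable.of_bound (C := K)
    (measurable_klFun.comp (hL.measurable_mixture p)).aestronglyMeasurable
    (Eventually.of_forall (hK p hp))

lemma BoundedDensities.continuous_divergence (hL : BoundedDensities ν L M) :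
    Continuous fun p : stdSimplex ℝ ι => mixtureDivergence ν L p := by
  obtain ⟨K, hK⟩ := hL.exists_klFun_bound
  refine continuous_of_dominated (bound := fun _ => K)
    (fun p => (measurable_klFun.comp (hL.measurable_mixture p)).aestronglyMeasurable)
    (fun p => Eventually.of_forall (hK p p.2)) (integrable_const K)
    (Eventually.of_forall fun y => ?_)
  refine continuous_klFun.comp ?_
  unfold mixture
  exact continuous_finsetSum _ fun j _ =>
    ((continuous_apply j).comp continuous_subtype_val).mul continuous_const

/-- The pointwise inequality `klFun_strong_convexity` with `c = g y`, integrated. Both mixtures have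
mass one, so the error is `(5 + 7) / 18 = 2 / 3` times `G ^ 2`. This plays the role of Pinsker's
inequality, paired directly with a bounded test function. -/
lemma BoundedDensities.divergence_strong_convexity (hL : BoundedDensities ν L M) {p q : ι → ℝ}
    (hp : p ∈ stdSimplex ℝ ι) (hq : q ∈ stdSimplex ℝ ι) {g : Y → ℝ} (hg : Measurable g)
    {G : ℝ} (hG : ∀ y, |g y| ≤ G) :
    4 * mixtureDivergence ν L (fun j => (p j + 3 * q j) / 4) - 3 * mixtureDivergence ν L q
      + ∑ j, (p j - q j) * ∫ y, L j y * g y ∂ν - 2 / 3 * G ^ 2 ≤ mixtureDivergence ν L p := by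
  have hr : (fun j => (p j + 3 * q j) / 4) ∈ stdSimplex ℝ ι := by
    refine ⟨fun j => ?_, ?_⟩
    · have := hp.1 j
      have := hq.1 j
      positivity
    · rw [← Finset.sum_div, Finset.sum_add_distrib, ← Finset.mul_sum, hp.2, hq.2]
      norm_num
  have hmr : ∀ y, mixture L (fun j => (p j + 3 * q j) / 4) y =
      (mixture L p y + 3 * mixture L q y) / 4 := by
    intro y
    simp only [mixture]
    rw [Finset.mul_sum, ← Finset.sum_add_distrib, Finset.sum_div]
    exact Finset.sum_congr rfl fun j _ => by ring
  have hmi : ∀ p, Integrable (fun y => mixture L p y * g y) ν := fun p =>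
    (hL.integrable_mixture p).mul_bdd hg.aestronglyMeasurable (Eventually.of_forall hG)
  have hsum : ∑ j, (p j - q j) * ∫ y, L j y * g y ∂ν =
      ∫ y, mixture L p y * g y ∂ν - ∫ y, mixture L q y * g y ∂ν := by
    rw [hL.integral_mixture_mul p hg hG, hL.integral_mixture_mul q hg hG,
      ← Finset.sum_sub_distrib]
    exact Finset.sum_congr rfl fun j _ => by ring
  have hpt : ∀ y, 4 * klFun (mixture L (fun j => (p j + 3 * q j) / 4) y)
      - 3 * klFun (mixture L q y) + (mixture L p y * g y - mixture L q y * g y)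
      - G ^ 2 * (5 * mixture L p y + 7 * mixture L q y) / 18 ≤ klFun (mixture L p y) := by
    intro y
    have h1 := klFun_strong_convexity (hL.mixture_pos hp y) (hL.mixture_pos hq y) (g y)
    have h2 : g y ^ 2 ≤ G ^ 2 := sq_le_sq.2 ((hG y).trans (le_abs_self G))
    have h3 : 0 ≤ 5 * mixture L p y + 7 * mixture L q y := by
      linarith [hL.mixture_pos hp y, hL.mixture_pos hq y]
    rw [hmr]
    have := mul_le_mul_of_nonneg_right h2 h3
    linarith
  have i1 := (hL.integrable_klFun hr).const_mul 4
  have i2 := (hL.integrable_klFun hq).const_mul 3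
  have i3 := (hmi p).sub (hmi q)
  have i4 : Integrable (fun y => G ^ 2 * (5 * mixture L p y + 7 * mixture L q y) / 18) ν :=
    ((((hL.integrable_mixture p).const_mul 5).add
      ((hL.integrable_mixture q).const_mul 7)).const_mul (G ^ 2)).div_const 18
  have hle := integral_mono (((i1.sub i2).add i3).sub i4) (hL.integrable_klFun hp) hpt
  have e4 : ∫ y, G ^ 2 * (5 * mixture L p y + 7 * mixture L q y) / 18 ∂ν = 2 / 3 * G ^ 2 := by
    rw [integral_div, integral_const_mul, integral_add ((hL.integrable_mixture p).const_mul 5)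
      ((hL.integrable_mixture q).const_mul 7), integral_const_mul, integral_const_mul,
      hL.integral_mixture hp, hL.integral_mixture hq]
    ring
  rw [integral_sub' ((i1.sub i2).add i3) i4, integral_add' (i1.sub i2) i3, integral_sub' i1 i2,
    integral_sub' (hmi p) (hmi q), integral_const_mul, integral_const_mul, e4] at hle
  rw [hsum]
  exact hle

lemma BoundedDensities.continuous_linear_sub_divergence (hL : BoundedDensities ν L M) (τ : ℝ) :
    Continuous fun a : (ι → ℝ) × stdSimplex ℝ ι =>
      ∑ j, a.2.1 j * a.1 j - τ * mixtureDivergence ν L a.2 := by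
  refine Continuous.sub ?_ (continuous_const.mul (hL.continuous_divergence.comp continuous_snd))
  exact continuous_finsetSum _ fun j _ =>
    ((continuous_apply j).comp (continuous_subtype_val.comp continuous_snd)).mul
      ((continuous_apply j).comp continuous_fst)

lemma BoundedDensities.continuous_potential (hL : BoundedDensities ν L M) (τ : ℝ) :
    Continuous (mixturePotential ν L τ) :=
  isCompact_univ.continuous_sSup (hL.continuous_linear_sub_divergence τ)

lemma BoundedDensities.le_potential (hL : BoundedDensities ν L M) (τ : ℝ) (x : ι → ℝ)
    {p : ι → ℝ} (hp : p ∈ stdSimplex ℝ ι) :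
    ∑ j, p j * x j - τ * mixtureDivergence ν L p ≤ mixturePotential ν L τ x := by
  refine le_csSup (isCompact_univ.image ?_).bddAbove ⟨⟨p, hp⟩, trivial, rfl⟩
  exact (hL.continuous_linear_sub_divergence τ).comp (Continuous.prodMk_right x)

/-- A maximiser `q` at `x` satisfies a strengthened optimality condition, which is the analogue of
smoothness of the potential. -/
lemma BoundedDensities.maximizer_strong_optimality (hL : BoundedDensities ν L M) {τ : ℝ}
    (hτ : 0 < τ) {x : ι → ℝ} {p q : ι → ℝ} (hp : p ∈ stdSimplex ℝ ι) (hq : q ∈ stdSimplex ℝ ι)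
    (hqx : mixturePotential ν L τ x = ∑ j, q j * x j - τ * mixtureDivergence ν L q)
    {g : Y → ℝ} (hg : Measurable g) {G : ℝ} (hG : ∀ y, |g y| ≤ G) :
    ∑ j, p j * x j - τ * mixtureDivergence ν L p + ∑ j, (p j - q j) * ∫ y, L j y * g y ∂ν
      ≤ mixturePotential ν L τ x + 2 / 3 * G ^ 2 / τ := by
  have hr : (fun j => (p j + 3 * q j) / 4) ∈ stdSimplex ℝ ι := by
    refine ⟨fun j => ?_, ?_⟩
    · have := hp.1 j
      have := hq.1 j
      positivity
    · rw [← Finset.sum_div, Finset.sum_add_distrib, ← Finset.mul_sum, hp.2, hq.2]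
      norm_num
  -- Optimality of `q` is used only against the competitor `(p + 3 * q) / 4`, so the divergence
  -- never has to be differentiated.
  have h1 := hL.le_potential τ x hr
  -- Dividing the test function by `τ` makes the pairing with `g` exact after multiplication by `τ`,
  -- with error `2 / 3 * G ^ 2 / τ`.
  have h2 := hL.divergence_strong_convexity hp hq (g := fun y => g y / τ) (hg.div_const τ)
    (G := G / τ) (fun y => by rw [abs_div, abs_of_pos hτ]; gcongr; exact hG y)
  have e1 : ∑ j, (p j + 3 * q j) / 4 * x j = (∑ j, p j * x j + 3 * ∑ j, q j * x j) / 4 := by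
    rw [Finset.mul_sum, ← Finset.sum_add_distrib, Finset.sum_div]
    exact Finset.sum_congr rfl fun j _ => by ring
  have e2 : ∑ j, (p j - q j) * ∫ y, L j y * (g y / τ) ∂ν =
      (∑ j, (p j - q j) * ∫ y, L j y * g y ∂ν) / τ := by
    rw [Finset.sum_div]
    refine Finset.sum_congr rfl fun j _ => ?_
    simp only [← mul_div_assoc]
    rw [integral_div, mul_div_assoc]
  rw [e1, hqx] at h1
  rw [e2] at h2
  have h3 := mul_le_mul_of_nonneg_left h2 hτ.le
  have e3 : τ * ((∑ j, (p j - q j) * ∫ y, L j y * g y ∂ν) / τ) =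
      ∑ j, (p j - q j) * ∫ y, L j y * g y ∂ν := by field_simp
  have e4 : τ * (2 / 3 * (G / τ) ^ 2) = 2 / 3 * G ^ 2 / τ := by field_simp
  rw [mul_sub, mul_add, e3, e4] at h3
  rw [hqx]
  linarith

variable [Nonempty ι]

lemma BoundedDensities.exists_potential_eq (hL : BoundedDensities ν L M) (τ : ℝ) (x : ι → ℝ) :
    ∃ q ∈ stdSimplex ℝ ι,
      mixturePotential ν L τ x = ∑ j, q j * x j - τ * mixtureDivergence ν L q := by
  classical
  have hc : Continuous fun p : stdSimplex ℝ ι =>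
      ∑ j, p.1 j * x j - τ * mixtureDivergence ν L p :=
    (hL.continuous_linear_sub_divergence τ).comp (Continuous.prodMk_right x)
  obtain ⟨q, -, hq⟩ := (isCompact_univ (X := stdSimplex ℝ ι)).exists_sSup_image_eq
    ⟨⟨_, single_mem_stdSimplex ℝ (Classical.arbitrary ι)⟩, trivial⟩ hc.continuousOn
  exact ⟨q, q.2, hq⟩

end Potential

/-! ### Exponential moments along an i.i.d. sample. -/

/-- Multiply by `exp x ≥ 1 + x + x ^ 2 / 2`: the product of the two quadratics is `1 + x ^ 4 / 4 ≥
1`. -/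
lemma exp_neg_le_one_sub_add_sq_div_two {x : ℝ} (hx : 0 ≤ x) :
    Real.exp (-x) ≤ 1 - x + x ^ 2 / 2 := by
  have h1 : 1 + x + x ^ 2 / 2 ≤ Real.exp x := Real.quadratic_le_exp_of_nonneg hx
  have h2 : (1 - x + x ^ 2 / 2) * (1 + x + x ^ 2 / 2) = 1 + x ^ 4 / 4 := by ring
  have h3 : 0 < 1 - x + x ^ 2 / 2 := by nlinarith [sq_nonneg (x - 1)]
  rw [Real.exp_neg, inv_le_iff_one_le_mul₀ (Real.exp_pos x)]
  calc (1 : ℝ) ≤ 1 + x ^ 4 / 4 := by linarith [show 0 ≤ x ^ 4 by positivity]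
    _ = (1 - x + x ^ 2 / 2) * (1 + x + x ^ 2 / 2) := h2.symm
    _ ≤ _ := mul_le_mul_of_nonneg_left h1 h3.le

/-- The one-sided sub-Gaussian bound for the lower tail of a nonnegative random variable. -/
lemma lintegral_exp_mul_integral_sub_le {Z : Type*} [MeasurableSpace Z] {μ : Measure Z}
    [IsProbabilityMeasure μ] {X : Z → ℝ} {B σ a : ℝ} (hX : Measurable X) (h0 : ∀ z, 0 ≤ X z)
    (hB : ∀ z, X z ≤ B) (hσ : ∫ z, X z ^ 2 ∂μ ≤ σ ^ 2) (ha : 0 ≤ a) :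
    ∫⁻ z, ENNReal.ofReal (Real.exp (a * (∫ z', X z' ∂μ - X z))) ∂μ
      ≤ ENNReal.ofReal (Real.exp (a ^ 2 * σ ^ 2 / 2)) := by
  have hXi : Integrable X μ := Integrable.of_bound (C := B) hX.aestronglyMeasurable
    (Eventually.of_forall fun z => by rw [Real.norm_eq_abs, abs_of_nonneg (h0 z)]; exact hB z)
  have hX2i : Integrable (fun z => X z ^ 2) μ :=
    Integrable.of_bound (C := B ^ 2) (hX.pow_const 2).aestronglyMeasurable
      (Eventually.of_forall fun z => by
        rw [Real.norm_eq_abs, abs_of_nonneg (sq_nonneg _)]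
        exact pow_le_pow_left₀ (h0 z) (hB z) 2)
  set m := ∫ z', X z' ∂μ with hm
  have hpt : ∀ z, Real.exp (a * (m - X z))
      ≤ Real.exp (a * m) * (1 - a * X z + a ^ 2 / 2 * X z ^ 2) := by
    intro z
    rw [mul_sub, sub_eq_add_neg, Real.exp_add]
    refine mul_le_mul_of_nonneg_left ?_ (Real.exp_pos _).le
    have := exp_neg_le_one_sub_add_sq_div_two (mul_nonneg ha (h0 z))
    linarith [this]
  have i1 : Integrable (fun z => 1 - a * X z) μ := (integrable_const 1).sub (hXi.const_mul a)
  have i2 : Integrable (fun z => a ^ 2 / 2 * X z ^ 2) μ := hX2i.const_mul _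
  have hint : Integrable (fun z => Real.exp (a * m) * (1 - a * X z + a ^ 2 / 2 * X z ^ 2)) μ :=
    (i1.add i2).const_mul _
  calc _ ≤ ∫⁻ z, ENNReal.ofReal
        (Real.exp (a * m) * (1 - a * X z + a ^ 2 / 2 * X z ^ 2)) ∂μ :=
        lintegral_mono fun z => ENNReal.ofReal_le_ofReal (hpt z)
    _ = ENNReal.ofReal (∫ z, Real.exp (a * m) * (1 - a * X z + a ^ 2 / 2 * X z ^ 2) ∂μ) :=
        (ofReal_integral_eq_lintegral_ofReal hint (Eventually.of_forall fun z =>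
          (Real.exp_pos _).le.trans (hpt z))).symm
    _ ≤ _ := by
        refine ENNReal.ofReal_le_ofReal ?_
        rw [integral_const_mul, integral_add i1 i2,
          integral_sub (integrable_const 1) (hXi.const_mul a), integral_const_mul,
          integral_const_mul, ← hm]
        simp only [integral_const, probReal_univ, smul_eq_mul, mul_one]
        calc Real.exp (a * m) * (1 - a * m + a ^ 2 / 2 * ∫ z, X z ^ 2 ∂μ)
            ≤ Real.exp (a * m) * Real.exp (-(a * m) + a ^ 2 * σ ^ 2 / 2) := by
              refine mul_le_mul_of_nonneg_left ?_ (Real.exp_pos _).le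
              have h1 := Real.add_one_le_exp (-(a * m) + a ^ 2 * σ ^ 2 / 2)
              have h2 := mul_le_mul_of_nonneg_left hσ (show 0 ≤ a ^ 2 / 2 by positivity)
              linarith
          _ = Real.exp (a ^ 2 * σ ^ 2 / 2) := by rw [← Real.exp_add]; congr 1; ring

/-- A one-step contraction estimate iterates along an i.i.d. sample. -/
lemma lintegral_pi_add_sum_le {Z E : Type*} [MeasurableSpace Z] [AddCommMonoid E]
    [MeasurableSpace E] [MeasurableAdd₂ E] {μ : Measure Z} [IsProbabilityMeasure μ]
    {V : E → ℝ≥0∞} (hV : Measurable V) {h : Z → E} (hh : Measurable h) {C : ℝ≥0∞}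
    (hstep : ∀ x, ∫⁻ z, V (x + h z) ∂μ ≤ C * V x) (n : ℕ) (x : E) :
    ∫⁻ s, V (x + ∑ i, h (s i)) ∂(Measure.pi fun _ : Fin n => μ) ≤ C ^ n * V x := by
  induction n generalizing x with
  | zero => simp
  | succ n ih =>
    have hmp := (measurePreserving_piFinSuccAbove (fun _ : Fin (n + 1) => μ) 0).symm
    have hm : Measurable fun s : Fin (n + 1) → Z => V (x + ∑ i, h (s i)) := by
      refine hV.comp (measurable_const.add ?_)
      exact Finset.measurable_sum _ fun i _ => hh.comp (measurable_pi_apply i)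
    rw [← hmp.lintegral_comp hm]
    refine (lintegral_prod _ (hm.comp hmp.measurable).aemeasurable).trans_le ?_
    calc _ = ∫⁻ z, ∫⁻ s, V (x + h z + ∑ i, h (s i)) ∂(Measure.pi fun _ : Fin n => μ) ∂μ := by
          refine lintegral_congr fun z => lintegral_congr fun s => ?_
          simp only [MeasurableEquiv.piFinSuccAbove_symm_apply, Fin.sum_univ_succ]
          simp [Fin.insertNthEquiv, add_assoc]
      _ ≤ ∫⁻ z, C ^ n * V (x + h z) ∂μ := lintegral_mono fun z => ih (x + h z)
      _ = C ^ n * ∫⁻ z, V (x + h z) ∂μ :=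
          lintegral_const_mul _ (hV.comp (measurable_const.add hh))
      _ ≤ C ^ n * (C * V x) := by gcongr; exact hstep x
      _ = C ^ (n + 1) * V x := by ring

/-- The loss vector `f z` is represented by functions on `Y` of oscillation at most `G`. -/
def HasOscRepresentation {ι Y Z : Type*} [MeasurableSpace Y] (ν : Measure Y) (L : ι → Y → ℝ)
    (f : Z → ι → ℝ) (G : ℝ) : Prop :=
  ∃ g : Z → Y → ℝ, (∀ z, Measurable (g z)) ∧ (∃ B, ∀ z y, |g z y| ≤ B) ∧
    (∀ z z' y, |g z' y - g z y| ≤ G) ∧ ∀ z j, ∫ y, L j y * g z y ∂ν = f z j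

section Step

variable {ι Y Z : Type*} [Fintype ι] [Nonempty ι] [MeasurableSpace Y] [MeasurableSpace Z]
  {ν : Measure Y} [IsProbabilityMeasure ν] {L : ι → Y → ℝ} {M : ℝ}
  {μ : Measure Z} [IsProbabilityMeasure μ] {f : Z → ι → ℝ} {G B τ σ a : ℝ}

/-- The increment is an average over an independent `z'` of differences `f z' - f z`, each
represented by a function bounded by `G`. Strong optimality is applied for each `z'` and averaged
afterwards, so `g` need not be measurable in `z`. The maximizer `q` depends on `x` only, not on `z`,
so the linear term has mean zero. -/
lemma BoundedDensities.exists_potential_add_le (hL : BoundedDensities ν L M) (hτ : 0 < τ)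
    (hf : Measurable f) (h0 : ∀ z j, 0 ≤ f z j) (hB : ∀ z j, f z j ≤ B)
    (hG : HasOscRepresentation ν L f G) (x : ι → ℝ) :
    ∃ q ∈ stdSimplex ℝ ι, ∀ z,
      mixturePotential ν L τ (x + fun j => ∫ z', f z' j ∂μ - f z j) ≤
        mixturePotential ν L τ x + ∑ j, q j * (∫ z', f z' j ∂μ - f z j) + 2 / 3 * G ^ 2 / τ := by
  obtain ⟨g, hgm, ⟨K, hK⟩, hgG, hgf⟩ := hG
  obtain ⟨q, hq, hqx⟩ := hL.exists_potential_eq τ x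
  have hfi : ∀ j, Integrable (fun z => f z j) μ := fun j =>
    Integrable.of_bound (C := B) ((measurable_pi_apply j).comp hf).aestronglyMeasurable
      (Eventually.of_forall fun z => by
        rw [Real.norm_eq_abs, abs_of_nonneg (h0 z j)]; exact hB z j)
  refine ⟨q, hq, fun z => mixturePotential_le fun p hp => ?_⟩
  have hpair : ∀ z', ∑ j, (p j - q j) * (f z' j - f z j) ≤
      mixturePotential ν L τ x + 2 / 3 * G ^ 2 / τ -
        (∑ j, p j * x j - τ * mixtureDivergence ν L p) := by
    intro z'
    have h := hL.maximizer_strong_optimality hτ hp hq hqx (g := fun y => g z' y - g z y)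
      ((hgm z').sub (hgm z)) (hgG z z')
    have e : ∀ j, ∫ y, L j y * (g z' y - g z y) ∂ν = f z' j - f z j := by
      intro j
      simp only [mul_sub]
      rw [integral_sub, hgf, hgf]
      · exact (hL.integrable j).mul_bdd (hgm z').aestronglyMeasurable
          (Eventually.of_forall (hK z'))
      · exact (hL.integrable j).mul_bdd (hgm z).aestronglyMeasurable
          (Eventually.of_forall (hK z))
    simp only [e] at h
    linarith
  have hi : ∀ j, Integrable (fun z' => (p j - q j) * (f z' j - f z j)) μ := fun j =>
    ((hfi j).sub (integrable_const _)).const_mul _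
  have havg := integral_mono (integrable_finsetSum Finset.univ fun j _ => hi j)
    (integrable_const (μ := μ) _) hpair
  rw [integral_finsetSum _ fun j _ => hi j] at havg
  simp only [integral_const_mul, integral_const, probReal_univ, smul_eq_mul, one_mul] at havg
  have e2 : ∀ j, ∫ z', (f z' j - f z j) ∂μ = ∫ z', f z' j ∂μ - f z j := fun j => by
    rw [integral_sub (hfi j) (integrable_const _)]
    simp
  simp only [e2, sub_mul, Finset.sum_sub_distrib] at havg
  simp only [Pi.add_apply, mul_add, Finset.sum_add_distrib]
  linarith

/-- The exponential moment of the potential of the empirical process. -/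
lemma BoundedDensities.lintegral_exp_potential_le (hL : BoundedDensities ν L M) (hτ : 0 < τ)
    (hf : Measurable f) (h0 : ∀ z j, 0 ≤ f z j) (hB : ∀ z j, f z j ≤ B)
    (hG : HasOscRepresentation ν L f G) (hσ : ∀ j, ∫ z, f z j ^ 2 ∂μ ≤ σ ^ 2) (ha : 0 ≤ a)
    (n : ℕ) :
    ∫⁻ s, ENNReal.ofReal (Real.exp (a * mixturePotential ν L τ
        (fun j => ∑ i, (∫ z', f z' j ∂μ - f (s i) j)))) ∂(Measure.pi fun _ : Fin n => μ)
      ≤ ENNReal.ofReal (Real.exp (n * (a * (2 / 3 * G ^ 2 / τ) + a ^ 2 * σ ^ 2 / 2))) := by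
  have hfj : ∀ j, Measurable fun z => f z j := fun j => (measurable_pi_apply j).comp hf
  have hΨ := (hL.continuous_potential τ).measurable
  have hV : Measurable fun x => ENNReal.ofReal (Real.exp (a * mixturePotential ν L τ x)) := by
    fun_prop
  have hh : Measurable fun (z : Z) (j : ι) => ∫ z', f z' j ∂μ - f z j :=
    measurable_pi_lambda _ fun j => measurable_const.sub (hfj j)
  have hfi : ∀ j, Integrable (fun z => f z j) μ := fun j =>
    Integrable.of_bound (C := B) (hfj j).aestronglyMeasurable
      (Eventually.of_forall fun z => by
        rw [Real.norm_eq_abs, abs_of_nonneg (h0 z j)]; exact hB z j)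
  have hfi2 : ∀ j, Integrable (fun z => f z j ^ 2) μ := fun j =>
    Integrable.of_bound (C := B ^ 2) ((hfj j).pow_const 2).aestronglyMeasurable
      (Eventually.of_forall fun z => by
        rw [Real.norm_eq_abs, abs_of_nonneg (sq_nonneg _)]
        exact pow_le_pow_left₀ (h0 z j) (hB z j) 2)
  have hstep : ∀ x : ι → ℝ, ∫⁻ z, ENNReal.ofReal (Real.exp (a * mixturePotential ν L τ
      (x + fun j => ∫ z', f z' j ∂μ - f z j))) ∂μ
      ≤ ENNReal.ofReal (Real.exp (a * (2 / 3 * G ^ 2 / τ) + a ^ 2 * σ ^ 2 / 2))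
        * ENNReal.ofReal (Real.exp (a * mixturePotential ν L τ x)) := by
    intro x
    obtain ⟨q, hq, hqx⟩ := hL.exists_potential_add_le (μ := μ) hτ hf h0 hB hG x
    have hXm : Measurable fun z => ∑ j, q j * f z j :=
      Finset.measurable_sum _ fun j _ => (hfj j).const_mul _
    -- By convexity of the square, the second moment bound passes to the `q`-average of the losses.
    have hX2 : ∫ z, (∑ j, q j * f z j) ^ 2 ∂μ ≤ σ ^ 2 := by
      have hpt : ∀ z, (∑ j, q j * f z j) ^ 2 ≤ ∑ j, q j * f z j ^ 2 := fun z => by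
        have := (Even.convexOn_pow (𝕜 := ℝ) even_two).map_sum_le (t := Finset.univ) (w := q)
          (p := f z) (fun j _ => hq.1 j) hq.2 (fun _ _ => Set.mem_univ _)
        simpa using this
      calc _ ≤ ∫ z, ∑ j, q j * f z j ^ 2 ∂μ := by
            refine integral_mono_of_nonneg (Eventually.of_forall fun z => sq_nonneg _)
              (integrable_finsetSum _ fun j _ => (hfi2 j).const_mul _)
              (Eventually.of_forall hpt)
        _ = ∑ j, q j * ∫ z, f z j ^ 2 ∂μ := by
            rw [integral_finsetSum _ fun j _ => (hfi2 j).const_mul _]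
            simp only [integral_const_mul]
        _ ≤ ∑ j, q j * σ ^ 2 :=
            Finset.sum_le_sum fun j _ => mul_le_mul_of_nonneg_left (hσ j) (hq.1 j)
        _ = σ ^ 2 := by rw [← Finset.sum_mul, hq.2, one_mul]
    have hmgf := lintegral_exp_mul_integral_sub_le (μ := μ) (B := B) hXm
      (fun z => Finset.sum_nonneg fun j _ => mul_nonneg (hq.1 j) (h0 z j))
      (fun z => by
        calc ∑ j, q j * f z j ≤ ∑ j, q j * B :=
              Finset.sum_le_sum fun j _ => mul_le_mul_of_nonneg_left (hB z j) (hq.1 j)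
          _ = B := by rw [← Finset.sum_mul, hq.2, one_mul]) hX2 ha
    have eX : ∫ z, ∑ j, q j * f z j ∂μ = ∑ j, q j * ∫ z, f z j ∂μ := by
      rw [integral_finsetSum _ fun j _ => (hfi j).const_mul _]
      simp only [integral_const_mul]
    have hpt : ∀ z, ENNReal.ofReal (Real.exp (a * mixturePotential ν L τ
        (x + fun j => ∫ z', f z' j ∂μ - f z j))) ≤
        ENNReal.ofReal (Real.exp (a * mixturePotential ν L τ x + a * (2 / 3 * G ^ 2 / τ))) *
        ENNReal.ofReal (Real.exp (a * (∫ z', ∑ j, q j * f z' j ∂μ - ∑ j, q j * f z j))) := by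
      intro z
      rw [← ENNReal.ofReal_mul (Real.exp_pos _).le, ← Real.exp_add, eX,
        ← Finset.sum_sub_distrib]
      refine ENNReal.ofReal_le_ofReal (Real.exp_le_exp.2 ?_)
      have := mul_le_mul_of_nonneg_left (hqx z) ha
      simp only [mul_sub] at this ⊢
      linarith
    refine (lintegral_mono hpt).trans ?_
    rw [lintegral_const_mul _ (by fun_prop)]
    refine (mul_le_mul_right hmgf _).trans ?_
    rw [← ENNReal.ofReal_mul (Real.exp_pos _).le, ← ENNReal.ofReal_mul (Real.exp_pos _).le,
      ← Real.exp_add, ← Real.exp_add]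
    refine ENNReal.ofReal_le_ofReal (Real.exp_le_exp.2 ?_)
    linarith
  have hiter := lintegral_pi_add_sum_le hV hh hstep n 0
  have e0 : ∀ s : Fin n → Z, (0 : ι → ℝ) + ∑ i, (fun j => ∫ z', f z' j ∂μ - f (s i) j) =
      fun j => ∑ i, (∫ z', f z' j ∂μ - f (s i) j) := by
    intro s
    ext j
    simp
  simp only [e0] at hiter
  refine hiter.trans ?_
  rw [← ENNReal.ofReal_pow (Real.exp_pos _).le, ← ENNReal.ofReal_mul (by positivity),
    ← Real.exp_nat_mul]
  refine ENNReal.ofReal_le_ofReal ?_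
  -- The iteration starts at `0`, where the potential is at most `0`.
  refine mul_le_of_le_one_right (Real.exp_pos _).le ?_
  rw [Real.exp_le_one_iff]
  exact mul_nonpos_of_nonneg_of_nonpos ha (hL.potential_zero_le hτ.le)

end Step

/-! ### The noise scale and the representation of the loss. -/

/-- For `d > 0` the choice `b = 1 / (2 * √d)` gives `1 / (2 * b ^ 2) = 2 * d` and `(1 + 1 / (4 * d))
^ d ≤ exp (1 / 4)`, which is below `1.3` because `1.3 ^ 4 > exp 1`. -/
lemma exists_laplace_scale (d : ℕ) : ∃ b : ℝ, 0 < b ∧ (1 + b ^ 2) ^ d ≤ 1.3 ∧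
    ∀ w : Hyp d, ‖w‖ ^ 2 / (2 * b ^ 2) ≤ 2 * d * ‖w‖ ^ 2 := by
  rcases Nat.eq_zero_or_pos d with rfl | hd
  · exact ⟨1, one_pos, by norm_num, fun w => by simp [Subsingleton.elim w 0]⟩
  have hd' : (0 : ℝ) < d := Nat.cast_pos.2 hd
  have hb2 : (1 / (2 * √(d : ℝ))) ^ 2 = 1 / (4 * d) := by
    rw [div_pow, mul_pow, Real.sq_sqrt hd'.le]
    norm_num
  refine ⟨1 / (2 * √d), by positivity, ?_, fun w => ?_⟩
  · rw [hb2]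
    have h1 : (1 + 1 / (4 * d) : ℝ) ^ d ≤ Real.exp (1 / 4) := by
      calc (1 + 1 / (4 * d) : ℝ) ^ d ≤ Real.exp (1 / (4 * d)) ^ d := by
            gcongr
            linarith [Real.add_one_le_exp (1 / (4 * d) : ℝ)]
        _ = Real.exp (1 / 4) := by
            rw [← Real.exp_nat_mul]
            congr 1
            field_simp
    have h2 : Real.exp (1 / 4) ≤ 1.3 := by
      have h3 : Real.exp (1 / 4) ^ 4 = Real.exp 1 := by
        rw [← Real.exp_nat_mul]
        norm_num
      have h4 : Real.exp (1 / 4) ^ 4 ≤ 1.3 ^ 4 := by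
        rw [h3]
        have := Real.exp_one_lt_d9
        norm_num at this ⊢
        linarith
      exact le_of_pow_le_pow_left₀ (by norm_num) (by norm_num) h4
    exact h1.trans h2
  · rw [hb2]
    apply le_of_eq
    field_simp
    ring

lemma boundedDensities_laplacePiRatio {d : ℕ} {ι : Type*} [Finite ι] {b : ℝ} (hb : 0 < b)
    (u : ι → Hyp d) : ∃ M, BoundedDensities (laplacePi d b)
      (fun j => laplacePiRatio b (WithLp.ofLp (u j))) M := by
  have := Fintype.ofFinite ι
  refine ⟨∑ j, ∏ i, Real.exp (|u j i| / b), ⟨fun j => ?_, fun j y => ?_, fun j y => ?_, fun j => ?_⟩⟩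
  · exact (continuous_laplacePiRatio _ _).measurable
  · exact laplacePiRatio_pos _ _ _
  · refine (laplacePiRatio_le hb _ _).trans ?_
    exact Finset.single_le_sum (f := fun j => ∏ i, Real.exp (|u j i| / b))
      (fun j _ => by positivity) (Finset.mem_univ j)
  · exact integral_laplacePiRatio hb _

/-- The loss lies in `[0, β]` and its deconvolution stays within `0.3 * β` of it, hence takes values
in an interval of length `1.6 * β`. Weighting by the density of the translate by `u j` moves the
Laplace average from `x` to `x + u j`. -/
lemma hasOscRepresentation_laplace {d : ℕ} {ι Z : Type*} {b β : ℝ} (hb : 0 < b)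
    (hb1 : (1 + b ^ 2) ^ d ≤ 1.3) {ℓ : Hyp d → Z → ℝ} (h0 : ∀ w z, 0 ≤ ℓ w z)
    (hℓ : ∀ z, DirDerivsBounded (fun w => ℓ w z) β) (hβ : 0 ≤ β) (x : Hyp d) (u : ι → Hyp d) :
    HasOscRepresentation (laplacePi d b) (fun j => laplacePiRatio b (WithLp.ofLp (u j)))
      (fun z j => ℓ (x + u j) z) (1.6 * β) := by
  have hex := fun z => (hℓ z).exists_laplace_deconv hb d
    (fun i => EuclideanSpace.single i (1 : ℝ)) (fun i => by simp)
  choose g hgB hgf hgint using hex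
  have hcont : ∀ z, Continuous fun y : Fin d → ℝ =>
      g z (x + ∑ i, y i • EuclideanSpace.single i (1 : ℝ)) := fun z => by
    have := (hgB z).continuous
    fun_prop
  refine ⟨fun z y => g z (x + ∑ i, y i • EuclideanSpace.single i (1 : ℝ)),
    fun z => (hcont z).measurable, ⟨_, fun z y => (hgB z).abs_le _⟩, fun z z' y => ?_,
    fun z j => ?_⟩
  · simp only
    set w := x + ∑ i, y i • EuclideanSpace.single i (1 : ℝ)
    have hle : β * ((1 + b ^ 2) ^ d - 1) ≤ 0.3 * β := by
      rw [mul_comm]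
      exact mul_le_mul_of_nonneg_right (by linarith) hβ
    have h1 := abs_le.1 ((hgf z w).trans hle)
    have h2 := abs_le.1 ((hgf z' w).trans hle)
    have h3 := h0 w z
    have h4 := h0 w z'
    have h5 := le_of_abs_le ((hℓ z).abs_le w)
    have h6 := le_of_abs_le ((hℓ z').abs_le w)
    rw [abs_le]
    constructor <;> linarith [h1.1, h1.2, h2.1, h2.2]
  · rw [integral_laplacePiRatio_mul hb _ (hcont z)]
    refine Eq.trans ?_ (hgint z (x + u j))
    refine integral_congr_ae (Eventually.of_forall fun y => ?_)
    simp only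
    congr 1
    have hu : u j = ∑ i, u j i • EuclideanSpace.single i (1 : ℝ) := by
      ext i
      simp [Finset.sum_apply, Pi.single_apply]
    nth_rewrite 2 [hu]
    simp only [Pi.add_apply, add_smul, Finset.sum_add_distrib]
    abel

lemma measurable_genError {d n : ℕ} {Z : Type*} [MeasurableSpace Z] {μ : Measure Z}
    {ℓ : Hyp d → Z → ℝ} (hm : ∀ w, Measurable (ℓ w)) (w : Hyp d) :
    Measurable fun s : Fin n → Z => genError ℓ μ w s := by
  have := hm w
  unfold genError empRisk
  fun_prop

/-! ### Exponential moment of the penalized supremum. -/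

section MGF

variable {d n : ℕ} {Z : Type*} [MeasurableSpace Z] {μ : Measure Z} [IsProbabilityMeasure μ]
  {ℓ : Hyp d → Z → ℝ} {β σ η lam : ℝ}

/-- The potential dominates its value at every vertex of the simplex, where the divergence is at
most `2 * d * ‖u j‖ ^ 2`. The supremum therefore sits inside the expectation without a factor
depending on the size of `ι`. -/
lemma lintegral_iSup_exp_genError_le_of_finite {ι : Type*} [Fintype ι] [Nonempty ι]
    (hm : ∀ w, Measurable (ℓ w)) (h0 : ∀ w z, 0 ≤ ℓ w z)
    (hℓ : ∀ z, DirDerivsBounded (fun w => ℓ w z) β) (hσ : ∀ w, ∫ z, ℓ w z ^ 2 ∂μ ≤ σ ^ 2)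
    (hβ : 0 ≤ β) (hη : 0 < η) (hlam : 0 ≤ lam) (hn : 0 < n) (x : Hyp d) (u : ι → Hyp d) :
    ∫⁻ s, ⨆ j, ENNReal.ofReal (Real.exp (lam *
        (genError ℓ μ (x + u j) s - 2 * d / (η * n) * ‖u j‖ ^ 2)))
          ∂(Measure.pi fun _ : Fin n => μ)
      ≤ ENNReal.ofReal (Real.exp (lam * (2 * β ^ 2 * η) + lam ^ 2 * σ ^ 2 / (2 * n))) := by
  classical
  obtain ⟨b, hb, hb1, hb2⟩ := exists_laplace_scale d
  have := isProbabilityMeasure_laplacePi d hb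
  obtain ⟨M, hL⟩ := boundedDensities_laplacePiRatio hb u
  have hn' : (0 : ℝ) < n := Nat.cast_pos.2 hn
  -- Here `τ = η⁻¹`, and `a = lam / n` turns the sum over the sample into the empirical mean.
  have hmgf := hL.lintegral_exp_potential_le (μ := μ) (B := β) (σ := σ) (a := lam / n)
    (f := fun z j => ℓ (x + u j) z) (inv_pos.2 hη)
    (measurable_pi_lambda _ fun j => hm _) (fun z j => h0 _ _)
    (fun z j => le_of_abs_le ((hℓ z).abs_le _))
    (hasOscRepresentation_laplace hb hb1 h0 hℓ hβ x u) (fun j => hσ _) (by positivity) n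
  refine (lintegral_mono fun s => ?_).trans (hmgf.trans ?_)
  · refine iSup_le fun j => ENNReal.ofReal_le_ofReal (Real.exp_le_exp.2 ?_)
    have hΨ := hL.le_potential η⁻¹ (fun j => ∑ i, (∫ z', ℓ (x + u j) z' ∂μ - ℓ (x + u j) (s i)))
      (single_mem_stdSimplex ℝ j)
    have hmix : mixture (fun j => laplacePiRatio b (WithLp.ofLp (u j))) (Pi.single j 1) =
        laplacePiRatio b (WithLp.ofLp (u j)) := by
      ext y
      simp [mixture, Pi.single_apply]
    have hdiv : mixtureDivergence (laplacePi d b)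
        (fun j => laplacePiRatio b (WithLp.ofLp (u j))) (Pi.single j 1) ≤ 2 * d * ‖u j‖ ^ 2 := by
      rw [mixtureDivergence, hmix]
      refine (integral_klFun_laplacePiRatio_le hb _).trans (le_trans (le_of_eq ?_) (hb2 (u j)))
      rw [EuclideanSpace.real_norm_sq_eq]
    have hlin : ∑ k, (Pi.single j 1 : ι → ℝ) k *
        ∑ i, (∫ z', ℓ (x + u k) z' ∂μ - ℓ (x + u k) (s i)) = n * genError ℓ μ (x + u j) s := by
      simp only [Pi.single_apply, ite_mul, one_mul, zero_mul, Finset.sum_ite_eq',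
        Finset.mem_univ, if_true]
      rw [Finset.sum_sub_distrib, genError, risk, empRisk]
      simp only [Finset.sum_const, Finset.card_univ, Fintype.card_fin, nsmul_eq_mul]
      field_simp
    rw [hlin] at hΨ
    have h1 := mul_le_mul_of_nonneg_left hdiv (inv_pos.2 hη).le
    have h2 : n * genError ℓ μ (x + u j) s - η⁻¹ * (2 * d * ‖u j‖ ^ 2) ≤
        mixturePotential (laplacePi d b) (fun j => laplacePiRatio b (WithLp.ofLp (u j))) η⁻¹
          (fun j => ∑ i, (∫ z', ℓ (x + u j) z' ∂μ - ℓ (x + u j) (s i))) := by linarith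
    have h3 := mul_le_mul_of_nonneg_left h2 (show 0 ≤ lam / n by positivity)
    refine le_trans (le_of_eq ?_) h3
    field_simp
  · refine ENNReal.ofReal_le_ofReal (Real.exp_le_exp.2 ?_)
    have e : n * (lam / n * (2 / 3 * (1.6 * β) ^ 2 / η⁻¹) + (lam / n) ^ 2 * σ ^ 2 / 2) =
        lam * (2 / 3 * 1.6 ^ 2 * (β ^ 2 * η)) + lam ^ 2 * σ ^ 2 / (2 * n) := by
      field_simp
    rw [e]
    -- The numerical slack: `2 / 3 * 1.6 ^ 2 ≈ 1.71`.
    have : 2 / 3 * 1.6 ^ 2 * (β ^ 2 * η) ≤ 2 * β ^ 2 * η := by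
      have : 0 ≤ β ^ 2 * η := by positivity
      norm_num
      linarith
    have := mul_le_mul_of_nonneg_left this hlam
    linarith

/-- The finite bound is uniform in the number of points, so monotone convergence along initial
segments reaches a countable family. -/
lemma lintegral_iSup_exp_genError_le
    (hm : ∀ w, Measurable (ℓ w)) (h0 : ∀ w z, 0 ≤ ℓ w z)
    (hℓ : ∀ z, DirDerivsBounded (fun w => ℓ w z) β) (hσ : ∀ w, ∫ z, ℓ w z ^ 2 ∂μ ≤ σ ^ 2)
    (hβ : 0 ≤ β) (hη : 0 < η) (hlam : 0 ≤ lam) (hn : 0 < n) (x : Hyp d) (u : ℕ → Hyp d) :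
    ∫⁻ s, ⨆ k, ENNReal.ofReal (Real.exp (lam *
        (genError ℓ μ (x + u k) s - 2 * d / (η * n) * ‖u k‖ ^ 2)))
          ∂(Measure.pi fun _ : Fin n => μ)
      ≤ ENNReal.ofReal (Real.exp (lam * (2 * β ^ 2 * η) + lam ^ 2 * σ ^ 2 / (2 * n))) := by
  set F : ℕ → (Fin n → Z) → ℝ≥0∞ := fun k s => ENNReal.ofReal (Real.exp (lam *
        (genError ℓ μ (x + u k) s - 2 * d / (η * n) * ‖u k‖ ^ 2))) with hF
  have hFm : ∀ k, Measurable (F k) := fun k => by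
    have := measurable_genError (n := n) (μ := μ) hm (x + u k)
    fun_prop
  have hsup : ∀ s, ⨆ k, F k s = ⨆ m : ℕ, ⨆ j : Fin (m + 1), F j s := fun s =>
    le_antisymm
      (iSup_le fun k => le_iSup_of_le k (le_iSup_of_le (Fin.last k) (by simp)))
      (iSup_le fun m => iSup_le fun j => le_iSup (fun k => F k s) j)
  refine (lintegral_congr hsup).trans_le ?_
  rw [lintegral_iSup (fun m => Measurable.iSup fun j => hFm _)]
  · exact iSup_le fun m => lintegral_iSup_exp_genError_le_of_finite hm h0 hℓ hσ hβ hη hlam hn x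
      fun j : Fin (m + 1) => u j
  · intro m m' hmm s
    exact iSup_le fun j => le_iSup_of_le (Fin.castLE (by omega) j) (by simp)

end MGF

/-! ### The penalized generalization error around a centre. -/

section Localized

variable {d n : ℕ} {Z : Type*} [MeasurableSpace Z] {μ : Measure Z} {ℓ : Hyp d → Z → ℝ} {β c : ℝ}

/-- The largest generalization error around `x`, penalized by `c` times the squared distance
to `x`. -/
noncomputable def penalizedGenError (ℓ : Hyp d → Z → ℝ) (μ : Measure Z) (c : ℝ) (x : Hyp d)
    (s : Fin n → Z) : ℝ :=
  ⨆ k : ℕ, (genError ℓ μ (x + TopologicalSpace.denseSeq (Hyp d) k) s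
    - c * ‖TopologicalSpace.denseSeq (Hyp d) k‖ ^ 2)

variable [IsProbabilityMeasure μ]

lemma continuous_risk (hm : ∀ w, Measurable (ℓ w))
    (hℓ : ∀ z, DirDerivsBounded (fun w => ℓ w z) β) : Continuous (risk ℓ μ) :=
  continuous_of_dominated (bound := fun _ => β) (fun w => (hm w).aestronglyMeasurable)
    (fun w => Eventually.of_forall fun z => (hℓ z).abs_le w) (integrable_const β)
    (Eventually.of_forall fun z => (hℓ z).continuous)

lemma continuous_genError (hm : ∀ w, Measurable (ℓ w))
    (hℓ : ∀ z, DirDerivsBounded (fun w => ℓ w z) β) (s : Fin n → Z) :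
    Continuous fun w => genError ℓ μ w s := by
  have h1 := continuous_risk (μ := μ) hm hℓ
  have h2 := fun z => (hℓ z).continuous
  unfold genError empRisk
  fun_prop

lemma abs_genError_le (h0 : ∀ w z, 0 ≤ ℓ w z)
    (hℓ : ∀ z, DirDerivsBounded (fun w => ℓ w z) β) (hn : 0 < n) (w : Hyp d) (s : Fin n → Z) :
    |genError ℓ μ w s| ≤ β := by
  have hn' : (0 : ℝ) < n := Nat.cast_pos.2 hn
  have hle : ∀ z, ℓ w z ≤ β := fun z => le_of_abs_le ((hℓ z).abs_le w)
  have r0 : 0 ≤ risk ℓ μ w := integral_nonneg fun z => h0 w z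
  have r1 : risk ℓ μ w ≤ β := by
    have := integral_mono_of_nonneg (μ := μ) (Eventually.of_forall fun z => h0 w z)
      (integrable_const β) (Eventually.of_forall hle)
    simpa [risk] using this
  have e0 : 0 ≤ empRisk ℓ w s :=
    mul_nonneg (by positivity) (Finset.sum_nonneg fun i _ => h0 w (s i))
  have e1 : empRisk ℓ w s ≤ β := by
    have : ∑ i, ℓ w (s i) ≤ n * β := by
      simpa using Finset.sum_le_sum fun i (_ : i ∈ Finset.univ) => hle (s i)
    rw [empRisk, one_div, inv_mul_le_iff₀ hn']
    exact this
  rw [genError, abs_le]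
  constructor <;> linarith

lemma bddAbove_penalized (h0 : ∀ w z, 0 ≤ ℓ w z)
    (hℓ : ∀ z, DirDerivsBounded (fun w => ℓ w z) β) (hn : 0 < n) (hc : 0 ≤ c) (x : Hyp d)
    (s : Fin n → Z) (k : ℕ) :
    genError ℓ μ (x + TopologicalSpace.denseSeq (Hyp d) k) s
      - c * ‖TopologicalSpace.denseSeq (Hyp d) k‖ ^ 2 ≤ β := by
  have h1 := le_of_abs_le (abs_genError_le (μ := μ) h0 hℓ hn
    (x + TopologicalSpace.denseSeq (Hyp d) k) s)
  have : 0 ≤ c * ‖TopologicalSpace.denseSeq (Hyp d) k‖ ^ 2 := by positivity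
  linarith

/-- Continuity in the displacement extends the supremum over a countable dense set to all of `Hyp
d`. -/
lemma genError_sub_le_penalized (hm : ∀ w, Measurable (ℓ w)) (h0 : ∀ w z, 0 ≤ ℓ w z)
    (hℓ : ∀ z, DirDerivsBounded (fun w => ℓ w z) β) (hn : 0 < n) (hc : 0 ≤ c) (x w : Hyp d)
    (s : Fin n → Z) :
    genError ℓ μ w s - c * ‖w - x‖ ^ 2 ≤ penalizedGenError ℓ μ c x s := by
  have hcont := continuous_genError (μ := μ) hm hℓ s
  have key : ∀ v : Hyp d, genError ℓ μ (x + v) s - c * ‖v‖ ^ 2 ≤ penalizedGenError ℓ μ c x s := by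
    intro v
    refine (TopologicalSpace.denseRange_denseSeq (Hyp d)).induction_on v ?_ fun k => ?_
    · exact isClosed_le (by fun_prop) continuous_const
    · exact le_ciSup (f := fun k => genError ℓ μ (x + TopologicalSpace.denseSeq (Hyp d) k) s
        - c * ‖TopologicalSpace.denseSeq (Hyp d) k‖ ^ 2)
        ⟨β, by rintro _ ⟨k, rfl⟩; exact bddAbove_penalized h0 hℓ hn hc x s k⟩ k
  simpa using key (w - x)

lemma abs_penalizedGenError_le (hm : ∀ w, Measurable (ℓ w)) (h0 : ∀ w z, 0 ≤ ℓ w z)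
    (hℓ : ∀ z, DirDerivsBounded (fun w => ℓ w z) β) (hn : 0 < n) (hc : 0 ≤ c) (x : Hyp d)
    (s : Fin n → Z) : |penalizedGenError ℓ μ c x s| ≤ β := by
  have h1 := genError_sub_le_penalized (μ := μ) hm h0 hℓ hn hc x x s
  have h2 := (abs_le.1 (abs_genError_le (μ := μ) h0 hℓ hn x s)).1
  refine abs_le.2 ⟨by simp at h1; linarith, ciSup_le fun k => bddAbove_penalized h0 hℓ hn hc x s k⟩

lemma measurable_penalizedGenError (hm : Measurable (Function.uncurry ℓ))
    (hℓ : ∀ z, DirDerivsBounded (fun w => ℓ w z) β) :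
    Measurable fun a : (Fin n → Z) × Hyp d => penalizedGenError ℓ μ c a.2 a.1 := by
  have hm' : ∀ w, Measurable (ℓ w) := fun w => hm.of_uncurry_left
  have hr := (continuous_risk (μ := μ) hm' hℓ).measurable
  refine Measurable.iSup fun k => ?_
  unfold genError empRisk
  refine ((hr.comp (by fun_prop)).sub (Measurable.const_mul (Finset.measurable_sum _
    fun i _ => ?_) _)).sub measurable_const
  exact hm.comp (f := fun a : (Fin n → Z) × Hyp d =>
    (a.2 + TopologicalSpace.denseSeq (Hyp d) k, a.1 i)) (by fun_prop)

lemma measurable_penalizedGenError_left (hm : Measurable (Function.uncurry ℓ))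
    (hℓ : ∀ z, DirDerivsBounded (fun w => ℓ w z) β) (s : Fin n → Z) :
    Measurable fun x => penalizedGenError ℓ μ c x s := by
  have h := measurable_penalizedGenError (n := n) (μ := μ) (c := c) hm hℓ
  have h2 : Measurable (Function.uncurry fun (s : Fin n → Z) (x : Hyp d) =>
    penalizedGenError ℓ μ c x s) := h
  exact h2.of_uncurry_left

lemma ofReal_exp_penalizedGenError_le (h0 : ∀ w z, 0 ≤ ℓ w z)
    (hℓ : ∀ z, DirDerivsBounded (fun w => ℓ w z) β) (hn : 0 < n) (hc : 0 ≤ c) {lam : ℝ}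
    (hlam : 0 ≤ lam) (x : Hyp d) (s : Fin n → Z) :
    ENNReal.ofReal (Real.exp (lam * penalizedGenError ℓ μ c x s)) ≤
      ⨆ k : ℕ, ENNReal.ofReal (Real.exp (lam *
        (genError ℓ μ (x + TopologicalSpace.denseSeq (Hyp d) k) s
          - c * ‖TopologicalSpace.denseSeq (Hyp d) k‖ ^ 2))) := by
  refine le_of_eq ?_
  have hmono : Monotone fun t : ℝ => ENNReal.ofReal (Real.exp (lam * t)) := fun a b hab =>
    ENNReal.ofReal_le_ofReal (Real.exp_le_exp.2 (mul_le_mul_of_nonneg_left hab hlam))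
  have hcont : Continuous fun t : ℝ => ENNReal.ofReal (Real.exp (lam * t)) :=
    ENNReal.continuous_ofReal.comp (by fun_prop)
  exact hmono.map_ciSup_of_continuousAt hcont.continuousAt
    ⟨β, by rintro _ ⟨k, rfl⟩; exact bddAbove_penalized h0 hℓ hn hc x s k⟩

end Localized

/-! ### Passage to couplings. -/

lemma ofReal_integral_le_lintegral_ofReal {α : Type*} [MeasurableSpace α] {π : Measure α}
    {f : α → ℝ} (hf : Integrable f π) :
    ENNReal.ofReal (∫ a, f a ∂π) ≤ ∫⁻ a, ENNReal.ofReal (f a) ∂π := by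
  have h := ofReal_integral_eq_lintegral_ofReal hf.pos_part
    (Eventually.of_forall fun a => le_max_right _ _)
  calc ENNReal.ofReal (∫ a, f a ∂π) ≤ ENNReal.ofReal (∫ a, max (f a) 0 ∂π) :=
        ENNReal.ofReal_le_ofReal (integral_mono hf hf.pos_part fun a => le_max_left _ _)
    _ = ∫⁻ a, ENNReal.ofReal (f a) ∂π := by simp [h]

/-- Kantorovich-type inequality: an inequality between `f` and `g` up to the squared distance
integrates to the squared Wasserstein-2 distance. -/
lemma ofReal_integral_sub_integral_le_wassersteinTwoSq {d : ℕ} {P Q : Measure (Hyp d)}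
    [IsProbabilityMeasure P] [IsProbabilityMeasure Q] {f g : Hyp d → ℝ} {c : ℝ} (hc : 0 ≤ c)
    (hc0 : c = 0 → d = 0)
    (hf : Integrable f P) (hg : Integrable g Q) (hfg : ∀ x y, f x - g y ≤ c * ‖x - y‖ ^ 2) :
    ENNReal.ofReal (∫ x, f x ∂P - ∫ y, g y ∂Q) ≤
      ENNReal.ofReal c * wassersteinTwoSq P Q := by
  have key : ∀ π : Measure (Hyp d × Hyp d), IsCoupling π P Q →
      ENNReal.ofReal (∫ x, f x ∂P - ∫ y, g y ∂Q) ≤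
        ENNReal.ofReal c * ∫⁻ p, ENNReal.ofReal (‖p.1 - p.2‖ ^ 2) ∂π := by
    rintro π ⟨rfl, rfl⟩
    have hf' : Integrable (fun p : Hyp d × Hyp d => f p.1) π := hf.comp_measurable measurable_fst
    have hg' : Integrable (fun p : Hyp d × Hyp d => g p.2) π := hg.comp_measurable measurable_snd
    rw [integral_map measurable_fst.aemeasurable hf.aestronglyMeasurable,
      integral_map measurable_snd.aemeasurable hg.aestronglyMeasurable,
      ← integral_sub hf' hg', ← lintegral_const_mul _ (by fun_prop)]
    refine (ofReal_integral_le_lintegral_ofReal (hf'.sub hg')).trans (lintegral_mono fun p => ?_)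
    rw [← ENNReal.ofReal_mul hc]
    exact ENNReal.ofReal_le_ofReal (hfg p.1 p.2)
  -- The factor can be moved inside the infimum only when it is nonzero; for `c = 0` the product
  -- coupling already suffices.
  rcases hc.eq_or_lt with h | hpos
  · obtain rfl := hc0 h.symm
    have h2 := key (P.prod Q) ⟨by simp, by simp⟩
    rw [← h, ENNReal.ofReal_zero, zero_mul] at h2
    exact h2.trans zero_le
  · rw [wassersteinTwoSq, ENNReal.mul_iInf_of_ne (by simpa using hpos) ENNReal.ofReal_ne_top]
    refine le_iInf fun π => ?_
    rw [ENNReal.mul_iInf_of_ne (by simpa using hpos) ENNReal.ofReal_ne_top]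
    exact le_iInf fun hπ => key π hπ

/-! ### Chernoff bound and conclusion. -/

section HighProbability

variable {d n : ℕ} {Z : Type*} [MeasurableSpace Z] {μ : Measure Z} [IsProbabilityMeasure μ]
  {ℓ : Hyp d → Z → ℝ} {β σ η : ℝ}

lemma lintegral_exp_penalizedGenError_le (hm : ∀ w, Measurable (ℓ w))
    (h0 : ∀ w z, 0 ≤ ℓ w z) (hℓ : ∀ z, DirDerivsBounded (fun w => ℓ w z) β)
    (hσ : ∀ w, ∫ z, ℓ w z ^ 2 ∂μ ≤ σ ^ 2) (hβ : 0 ≤ β) (hη : 0 < η) {lam : ℝ} (hlam : 0 ≤ lam)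
    (hn : 0 < n) (x : Hyp d) :
    ∫⁻ s, ENNReal.ofReal (Real.exp (lam * penalizedGenError ℓ μ (2 * d / (η * n)) x s))
        ∂(Measure.pi fun _ : Fin n => μ) ≤
      ENNReal.ofReal (Real.exp (lam * (2 * β ^ 2 * η) + lam ^ 2 * σ ^ 2 / (2 * n))) :=
  (lintegral_mono fun s => ofReal_exp_penalizedGenError_le h0 hℓ hn (by positivity) hlam x s).trans
    (lintegral_iSup_exp_genError_le hm h0 hℓ hσ hβ hη hlam hn x
      (TopologicalSpace.denseSeq (Hyp d)))

/-- Chernoff bound for the average of the penalized generalization error. -/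
lemma measure_integral_penalizedGenError_gt_le (hm : Measurable (Function.uncurry ℓ))
    (h0 : ∀ w z, 0 ≤ ℓ w z) (hℓ : ∀ z, DirDerivsBounded (fun w => ℓ w z) β)
    (hσ : ∀ w, ∫ z, ℓ w z ^ 2 ∂μ ≤ σ ^ 2) (hβ : 0 ≤ β) (hη : 0 < η) (hn : 0 < n)
    (P : Measure (Hyp d)) [IsProbabilityMeasure P] {lam : ℝ} (hlam : 0 ≤ lam) (K : ℝ) :
    Measure.pi (fun _ : Fin n => μ)
        {s | K < ∫ x, penalizedGenError ℓ μ (2 * d / (η * n)) x s ∂P} ≤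
      ENNReal.ofReal (Real.exp
        (lam * (2 * β ^ 2 * η) + lam ^ 2 * σ ^ 2 / (2 * n) - lam * K)) := by
  have hm' : ∀ w, Measurable (ℓ w) := fun w => hm.of_uncurry_left
  obtain ⟨c, hcdef⟩ : ∃ c : ℝ, c = 2 * d / (η * n) := ⟨_, rfl⟩
  have hc : 0 ≤ c := by rw [hcdef]; positivity
  have hmgf := fun x =>
    lintegral_exp_penalizedGenError_le (n := n) hm' h0 hℓ hσ hβ hη hlam hn x
  simp only [← hcdef] at hmgf ⊢
  have hX := measurable_penalizedGenError (n := n) (μ := μ) (c := c) hm hℓ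
  set H : (Fin n → Z) → ℝ≥0∞ := fun s =>
    ∫⁻ x, ENNReal.ofReal (Real.exp (lam * penalizedGenError ℓ μ c x s)) ∂P with hHdef
  have hHm : Measurable fun a : (Fin n → Z) × Hyp d =>
      ENNReal.ofReal (Real.exp (lam * penalizedGenError ℓ μ c a.2 a.1)) := by fun_prop
  have hH : Measurable H := hHm.lintegral_prod_right'
  -- `P` does not depend on the sample, so Fubini reduces this to the bound at a fixed centre, which
  -- is uniform in `x`.
  have hHint : ∫⁻ s, H s ∂(Measure.pi fun _ : Fin n => μ) ≤
      ENNReal.ofReal (Real.exp (lam * (2 * β ^ 2 * η) + lam ^ 2 * σ ^ 2 / (2 * n))) := by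
    rw [hHdef, lintegral_lintegral_swap (f := fun s x =>
      ENNReal.ofReal (Real.exp (lam * penalizedGenError ℓ μ c x s))) hHm.aemeasurable]
    calc _ ≤ ∫⁻ _ : Hyp d, ENNReal.ofReal
          (Real.exp (lam * (2 * β ^ 2 * η) + lam ^ 2 * σ ^ 2 / (2 * n))) ∂P := by
          exact lintegral_mono hmgf
      _ = _ := by simp
  have hsub : {s : Fin n → Z | K < ∫ x, penalizedGenError ℓ μ c x s ∂P} ⊆
      {s | ENNReal.ofReal (Real.exp (lam * K)) ≤ H s} := by
    intro s hs
    have hXs : Measurable fun x => penalizedGenError ℓ μ c x s :=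
      measurable_penalizedGenError_left hm hℓ s
    have hXb := fun x => abs_penalizedGenError_le (μ := μ) hm' h0 hℓ hn hc x s
    have hi : Integrable (fun x => lam * penalizedGenError ℓ μ c x s) P :=
      (Integrable.of_bound (C := β) hXs.aestronglyMeasurable
        (Eventually.of_forall hXb)).const_mul lam
    have hie : Integrable (fun x => Real.exp (lam * penalizedGenError ℓ μ c x s)) P := by
      refine Integrable.of_bound (C := Real.exp (lam * β)) (by fun_prop)
        (Eventually.of_forall fun x => ?_)
      rw [Real.norm_eq_abs, Real.abs_exp, Real.exp_le_exp]
      exact mul_le_mul_of_nonneg_left (le_of_abs_le (hXb x)) hlam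
    have hJ := convexOn_exp.map_integral_le Real.continuous_exp.continuousOn isClosed_univ
      (Eventually.of_forall fun _ => Set.mem_univ _) hi hie
    rw [integral_const_mul] at hJ
    have h1 : Real.exp (lam * K) ≤ Real.exp (lam * ∫ x, penalizedGenError ℓ μ c x s ∂P) :=
      Real.exp_le_exp.2 (mul_le_mul_of_nonneg_left (le_of_lt hs) hlam)
    calc ENNReal.ofReal (Real.exp (lam * K)) ≤
          ENNReal.ofReal (∫ x, Real.exp (lam * penalizedGenError ℓ μ c x s) ∂P) :=
          ENNReal.ofReal_le_ofReal (h1.trans hJ)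
      _ ≤ H s := ofReal_integral_le_lintegral_ofReal hie
  refine (measure_mono hsub).trans ?_
  have hM := (mul_meas_ge_le_lintegral (μ := Measure.pi fun _ : Fin n => μ) hH
    (ENNReal.ofReal (Real.exp (lam * K)))).trans hHint
  have hne : ENNReal.ofReal (Real.exp (lam * K)) ≠ 0 := by simp [Real.exp_pos]
  rw [mul_comm, ← ENNReal.le_div_iff_mul_le (Or.inl hne) (Or.inl ENNReal.ofReal_ne_top),
    ← ENNReal.ofReal_div_of_pos (Real.exp_pos _), ← Real.exp_sub] at hM
  exact hM

/-- With `l = log (1 / δ)`, the optimal `lam = √(2 * n * l) / σ` makes the exponent `l - 2 * l =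
-l`. -/
lemma measure_integral_penalizedGenError_gt_le_delta (hm : Measurable (Function.uncurry ℓ))
    (h0 : ∀ w z, 0 ≤ ℓ w z) (hℓ : ∀ z, DirDerivsBounded (fun w => ℓ w z) β)
    (hσ0 : 0 < σ) (hσ : ∀ w, ∫ z, ℓ w z ^ 2 ∂μ ≤ σ ^ 2) (hβ : 0 ≤ β) (hη : 0 < η) (hn : 0 < n)
    (P : Measure (Hyp d)) [IsProbabilityMeasure P] {δ : ℝ} (hδ0 : 0 < δ) (hδ1 : δ < 1) :
    Measure.pi (fun _ : Fin n => μ)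
        {s | 2 * β ^ 2 * η + √(2 * σ ^ 2 * Real.log (1 / δ) / n) <
          ∫ x, penalizedGenError ℓ μ (2 * d / (η * n)) x s ∂P} ≤ ENNReal.ofReal δ := by
  have hn' : (0 : ℝ) < n := Nat.cast_pos.2 hn
  set l := Real.log (1 / δ) with hl
  have hlpos : 0 < l := Real.log_pos (by rw [lt_div_iff₀ hδ0]; linarith)
  have h := measure_integral_penalizedGenError_gt_le hm h0 hℓ hσ hβ hη hn P
    (lam := √(2 * n * l) / σ) (by positivity) (2 * β ^ 2 * η + √(2 * σ ^ 2 * l / n))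
  refine h.trans (ENNReal.ofReal_le_ofReal (le_of_eq ?_))
  have e1 : (√(2 * n * l) / σ) ^ 2 * σ ^ 2 / (2 * n) = l := by
    rw [div_pow, Real.sq_sqrt (by positivity)]
    field_simp
  have e2 : √(2 * n * l) / σ * √(2 * σ ^ 2 * l / n) = 2 * l := by
    rw [div_mul_eq_mul_div, ← Real.sqrt_mul (by positivity)]
    have : 2 * n * l * (2 * σ ^ 2 * l / n) = (2 * σ * l) ^ 2 := by field_simp
    rw [this, Real.sqrt_sq (by positivity)]
    field_simp
  rw [e1, mul_add, e2]
  have e3 : Real.log δ = -l := by rw [hl, one_div, Real.log_inv, neg_neg]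
  rw [← Real.exp_log hδ0, e3]
  congr 1
  ring

end HighProbability

theorem mainTheorem10 {d : ℕ} {Z : Type*} [MeasurableSpace Z]
    (μ : Measure Z) [IsProbabilityMeasure μ]
    (ℓ : Hyp d → Z → ℝ) (hℓ_meas : Measurable (Function.uncurry ℓ))
    (hℓ_nonneg : ∀ w z, 0 ≤ ℓ w z)
    (b : ℕ → ℝ) (β : ℝ) (hb : ∀ j, b j ≤ β)
    (hℓ_smooth : ∀ z, IsInfinitelySmooth (fun w => ℓ w z) b)
    (σ : ℝ) (hσ : 0 < σ) (hℓ_moment : ∀ w, ∫ z, ℓ w z ^ 2 ∂μ ≤ σ ^ 2)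
    (η : ℝ) (hη : 0 < η) (P₁ : ProbabilityMeasure (Hyp d))
    (n : ℕ) (hn : 1 < n) (δ : ℝ) (hδ₀ : 0 < δ) (hδ₁ : δ < 1) :
    ∃ E : Set (Fin n → Z), MeasurableSet E ∧
      ENNReal.ofReal (1 - δ) ≤ Measure.pi (fun _ : Fin n => μ) E ∧
      ∀ s ∈ E, ∀ A : LearningAlgorithm d n Z,
        ((avgGenError ℓ μ A s : ℝ) : EReal) ≤
          ((ENNReal.ofReal (2 * (d : ℝ) / (η * (n : ℝ))) *
              wassersteinTwoSq (A s : Measure (Hyp d)) (P₁ : Measure (Hyp d)) : ℝ≥0∞) : EReal) +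
          ((2 * β ^ 2 * η + Real.sqrt (2 * σ ^ 2 * Real.log (1 / δ) / (n : ℝ)) : ℝ) : EReal) := by
  have hn0 : 0 < n := by omega
  have hn' : (0 : ℝ) < n := Nat.cast_pos.2 hn0
  have hℓ : ∀ z, DirDerivsBounded (fun w => ℓ w z) β := fun z =>
    (hℓ_smooth z).dirDerivsBounded hb fun w => hℓ_nonneg w z
  have hm' : ∀ w, Measurable (ℓ w) := fun w => hℓ_meas.of_uncurry_left
  obtain ⟨z₀⟩ : Nonempty Z := nonempty_of_isProbabilityMeasure μ
  have hβ : 0 ≤ β := (abs_nonneg _).trans ((hℓ z₀).abs_le 0)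
  set K := 2 * β ^ 2 * η + √(2 * σ ^ 2 * Real.log (1 / δ) / n) with hK
  set c : ℝ := 2 * d / (η * n) with hcdef
  have hc : 0 ≤ c := by positivity
  have hX := measurable_penalizedGenError (n := n) (μ := μ) (c := c) hℓ_meas hℓ
  have hXint : Measurable fun s : Fin n → Z =>
      ∫ x, penalizedGenError ℓ μ c x s ∂(P₁ : Measure (Hyp d)) :=
    (hX.stronglyMeasurable.integral_prod_right').measurable
  -- This event is defined before any algorithm is chosen, which makes the bound simultaneous.
  have hE : MeasurableSet {s : Fin n → Z |
      ∫ x, penalizedGenError ℓ μ c x s ∂(P₁ : Measure (Hyp d)) ≤ K} :=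
    measurableSet_le hXint measurable_const
  refine ⟨_, hE, ?_, fun s hs A => ?_⟩
  · have hcompl := measure_integral_penalizedGenError_gt_le_delta hℓ_meas hℓ_nonneg hℓ hσ
      hℓ_moment hβ hη hn0 (P₁ : Measure (Hyp d)) hδ₀ hδ₁
    have hset : {s : Fin n → Z | K < ∫ x, penalizedGenError ℓ μ c x s ∂(P₁ : Measure (Hyp d))} =
        {s : Fin n → Z | ∫ x, penalizedGenError ℓ μ c x s ∂(P₁ : Measure (Hyp d)) ≤ K}ᶜ := by
      ext s
      simp
    rw [hset, prob_compl_eq_one_sub hE] at hcompl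
    rw [ENNReal.ofReal_sub _ hδ₀.le, ENNReal.ofReal_one]
    exact tsub_le_iff_tsub_le.1 hcompl
  · have hgi : Integrable (fun w => genError ℓ μ w s) (A s : Measure (Hyp d)) :=
      Integrable.of_bound (C := β) (continuous_genError hm' hℓ s).aestronglyMeasurable
        (Eventually.of_forall fun w => abs_genError_le hℓ_nonneg hℓ hn0 w s)
    have hXi : Integrable (fun x => penalizedGenError ℓ μ c x s) (P₁ : Measure (Hyp d)) :=
      Integrable.of_bound (C := β) 
        (measurable_penalizedGenError_left hℓ_meas hℓ s).aestronglyMeasurable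
        (Eventually.of_forall fun x => abs_penalizedGenError_le hm' hℓ_nonneg hℓ hn0 hc x s)
    have hW := ofReal_integral_sub_integral_le_wassersteinTwoSq hc
      (fun h => by
        by_contra hd
        have : (0 : ℝ) < d := Nat.cast_pos.2 (Nat.pos_of_ne_zero hd)
        have : 0 < c := by positivity
        linarith) hgi hXi
      (fun w x => by linarith [genError_sub_le_penalized (μ := μ) hm' hℓ_nonneg hℓ hn0 hc x w s])
    have hle : avgGenError ℓ μ A s - K ≤ ∫ w, genError ℓ μ w s ∂(A s : Measure (Hyp d)) -
        ∫ x, penalizedGenError ℓ μ c x s ∂(P₁ : Measure (Hyp d)) := by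
      have : ∫ x, penalizedGenError ℓ μ c x s ∂(P₁ : Measure (Hyp d)) ≤ K := hs
      rw [avgGenError]
      linarith
    have hfin := (ENNReal.ofReal_le_ofReal hle).trans hW
    -- The Wasserstein term may be infinite, so the real constant `K` is split off first; truncation
    -- by `ENNReal.ofReal` only enlarges the remaining left side.
    calc ((avgGenError ℓ μ A s : ℝ) : EReal)
        = ((avgGenError ℓ μ A s - K : ℝ) : EReal) + (K : EReal) := by
          rw [← EReal.coe_add, sub_add_cancel]
      _ ≤ _ := by
          refine add_le_add_left ?_ _
          refine le_trans ?_ (EReal.coe_ennreal_le_coe_ennreal_iff.2 hfin)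
          rw [EReal.coe_ennreal_ofReal]
          exact EReal.coe_le_coe_iff.2 (le_max_left _ _)
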